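/- Let $H$ be a separable complex Hilbert space. Notation and conventions: - $\mathcal{E}\!f(H)$ is the set of effects on $H$, i.e. of bounded operators $A$ on $H$ with $0\le A\le \mathrm{id}$. It is a $\sigma$-effect module: $A\oplus B=A+B$, defined iff $A+B\le\mathrm{id}$; $A^{\bot}=\mathrm{id}-A$; scalars $r\in[0,1]$ act by multiplication. Here a $\sigma$-effect module is an effect algebra with a scalar multiplication by $[0,1]$ satisfying $r\cdot(s\cdot x)=(rs)\cdot x$, $(r+s)\cdot x=r\cdot x\oplus s\cdot x$ if $r+s\le 1$, $r\cdot(x\oplus y)=r\cdot x\oplus r\cdot y$ if $x\oplus y$ is defined, and $1\cdot x=x$, in which every countable chain has a join for the order $x\le y\iff\exists z\; x\oplus z=y$. Morphisms preserve $\oplus$, $(-)^{\bot}$, $0$, the scalar multiplication and joins of countable chains. The unit interval $[0,1]$ is a $\sigma$-effect module in the same way. - $\mathcal{G}$ is the Giry monad of probability measures on measurable spaces (where $\mathcal{G}(X)$ carries the smallest $\sigma$-algebra making all $\varphi\mapsto\varphi(M)$ measurable), and a $\mathcal{G}$-algebra is an Eilenberg–Moore algebra of $\mathcal{G}$; a morphism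 of $\mathcal{G}$-algebras is a measurable map that commutes with the structure maps. The interval $[0,1]$ is a $\mathcal{G}$-algebra via $\varphi\mapsto\int t\,\mathrm{d}\varphi(t)$. - $\mathcal{D\!M}(H)$ is the set of density matrices on $H$ (positive operators of trace $1$), with the Borel $\sigma$-algebra of the weak operator topology. It is a $\mathcal{G}$-algebra with structure map $\alpha(\varphi)=\int\rho\,\mathrm{d}\varphi(\rho)$, defined by $\langle\psi|\alpha(\varphi)|\psi\rangle=\int\langle\psi|\rho|\psi\rangle\,\mathrm{d}\varphi(\rho)$ for all $\psi\in H$. - For a $\sigma$-effect module $E$, the set $\mathrm{Hom}_{\sigma EMod}(E,[0,1])$ of morphisms carries the smallest $\sigma$-algebra making all evaluations $\omega\mapsto\omega(e)$ measurable, and is a $\mathcal{G}$-algebra via $\varphi\mapsto\bigl(e\mapsto\int\omega(e)\,\mathrm{d}\varphi(\omega)\bigr)$. For a $\mathcal{G}$-algebra $X$, the set $\mathrm{Hom}_{\mathcal{G}}(X,[0,1])$ of $\mathcal{G}$-algebra morphisms is a $\sigma$-effect module with the pointwise operations, $f\oplus g=f+g$ being defined iff $f+g\le 1$ everywhere. Then: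 1. The $\mathcal{G}$-algebras $\mathrm{Hom}_{\sigma EMod}(\mathcal{E}\!f(H),[0,1])$ and $\mathcal{D\!M}(H)$ are isomorphic. 2. The $\sigma$-effect modules $\mathrm{Hom}_{\mathcal{G}}(\mathcal{D\!M}(H),[0,1])$ and $\mathcal{E}\!f(H)$ are isomorphic. -/

import Mathlib

universe u v w

namespace EffectDuality

open MeasureTheory

/-- An effect algebra: `oplus` is a partial operation, `compl` the orthocomplement, and the unit is
`compl zero`. -/
class EffectAlgebra (X : Type u) where
  oplus : X → X → Part X
  compl : X → X
  zero : X
  oplus_comm : ∀ {x y z : X}, z ∈ oplus x y → z ∈ oplus y x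
  oplus_assoc : ∀ {x y z s t : X}, s ∈ oplus y z → t ∈ oplus x s →
    ∃ r ∈ oplus x y, t ∈ oplus r z
  oplus_zero : ∀ x : X, x ∈ oplus x zero
  one_mem_oplus_iff : ∀ {x y : X}, compl zero ∈ oplus x y ↔ y = compl x
  eq_zero_of_oplus_one : ∀ {x : X}, (oplus x (compl zero)).Dom → x = zero

namespace EffectAlgebra

variable {X : Type u} [EffectAlgebra X]

/-- The order of an effect algebra: `x ≤ y` iff `x ⊕ z = y` for some `z`. -/
def Le (x y : X) : Prop := ∃ z : X, y ∈ oplus x z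

/-- `z` is the join (least upper bound) of `S`. -/
def IsJoin (S : Set X) (z : X) : Prop :=
  (∀ x ∈ S, Le x z) ∧ ∀ t : X, (∀ x ∈ S, Le x t) → Le z t

/-- `S` is a countable chain. -/
def IsCountableChain (S : Set X) : Prop := S.Countable ∧ IsChain Le S

end EffectAlgebra

open EffectAlgebra

/-- An effect module: an effect algebra with a scalar multiplication by `[0,1]`. -/
class EffectModule (X : Type u) extends EffectAlgebra X where
  smul : unitInterval → X → X
  smul_smul : ∀ (r s : unitInterval) (x : X), smul r (smul s x) = smul (r * s) x
  add_smul : ∀ {r s t : unitInterval} (x : X), (r : ℝ) + s = t →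
    smul t x ∈ oplus (smul r x) (smul s x)
  smul_oplus : ∀ (r : unitInterval) {x y z : X}, z ∈ oplus x y →
    smul r z ∈ oplus (smul r x) (smul r y)
  one_smul : ∀ x : X, smul 1 x = x

/-- A `σ`-effect module: an effect module in which every countable chain has a join. -/
class SigmaEffectModule (X : Type u) extends EffectModule X where
  exists_join : ∀ S : Set X, IsCountableChain S → ∃ z : X, IsJoin S z

/-- Morphisms of `σ`-effect modules. -/
structure SigmaHom (X : Type u) (Y : Type v) [SigmaEffectModule X] [SigmaEffectModule Y] where
  toFun : X → Y
  map_oplus : ∀ {x y z : X}, z ∈ oplus x y → toFun z ∈ oplus (toFun x) (toFun y)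
  map_compl : ∀ x : X, toFun (compl x) = compl (toFun x)
  map_zero : toFun zero = zero
  map_smul : ∀ (r : unitInterval) (x : X),
    toFun (EffectModule.smul r x) = EffectModule.smul r (toFun x)
  map_join : ∀ (S : Set X) (z : X), IsCountableChain S → IsJoin S z →
    IsJoin (toFun '' S) (toFun z)

theorem SigmaHom.ext {X : Type u} {Y : Type v} [SigmaEffectModule X] [SigmaEffectModule Y]
    {f g : SigmaHom X Y} (h : ∀ x, f.toFun x = g.toFun x) : f = g := by
  cases f; cases g; congr; exact funext h

/-- Isomorphism of `σ`-effect modules: a pair of mutually inverse morphisms. -/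
def SigmaEffectModule.Isomorphic (X : Type u) (Y : Type v) [SigmaEffectModule X]
    [SigmaEffectModule Y] : Prop :=
  ∃ (f : SigmaHom X Y) (g : SigmaHom Y X),
    (∀ x, g.toFun (f.toFun x) = x) ∧ ∀ y, f.toFun (g.toFun y) = y

/-! The unit interval as a `σ`-effect module. -/

noncomputable instance instEffectModuleUnitInterval : EffectModule unitInterval where
  oplus x y := ⟨(x : ℝ) + y ≤ 1, fun h => ⟨(x : ℝ) + y, add_nonneg x.2.1 y.2.1, h⟩⟩
  compl x := unitInterval.symm x
  zero := 0
  oplus_comm := by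
    rintro x y z ⟨h, rfl⟩
    exact ⟨by simpa [add_comm] using h, Subtype.ext (add_comm _ _)⟩
  oplus_assoc := by
    rintro x y z s t ⟨h, rfl⟩ ⟨h', rfl⟩
    have h'' : (x : ℝ) + (y + z) ≤ 1 := h'
    have hz := z.2.1
    exact ⟨_, ⟨by linarith, rfl⟩, ⟨by simpa [add_assoc] using h'', Subtype.ext (add_assoc _ _ _)⟩⟩
  oplus_zero x := ⟨by simpa using x.2.2, Subtype.ext (add_zero _)⟩
  one_mem_oplus_iff := by
    intro x y
    constructor
    · rintro ⟨h, h'⟩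
      have : (x : ℝ) + y = 1 := by simpa using congrArg Subtype.val h'
      exact Subtype.ext (by simp; linarith)
    · rintro rfl
      exact ⟨by simp, Subtype.ext (by simp)⟩
  eq_zero_of_oplus_one := by
    intro x h
    have h : (x : ℝ) + (unitInterval.symm 0 : unitInterval) ≤ 1 := h
    have hx := x.2.1
    simp at h
    exact Subtype.ext (le_antisymm (Subtype.coe_le_coe.2 h) hx)
  smul r x := r * x
  smul_smul r s x := (mul_assoc r s x).symm
  add_smul := by
    intro r s t x h
    have : (r : ℝ) * x + s * x = t * x := by rw [← h]; ring
    exact ⟨this.trans_le (mul_le_one₀ t.2.2 x.2.1 x.2.2), Subtype.ext this⟩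
  smul_oplus := by
    rintro r x y z ⟨h, rfl⟩
    have : (r : ℝ) * x + r * y = r * (x + y) := by ring
    exact ⟨this.trans_le (mul_le_one₀ r.2.2 (add_nonneg x.2.1 y.2.1) h), Subtype.ext this⟩
  one_smul x := one_mul x

theorem unitInterval_le_iff {x y : unitInterval} : Le x y ↔ x ≤ y := by
  constructor
  · rintro ⟨z, h, rfl⟩
    exact Subtype.coe_le_coe.1 (le_add_of_nonneg_right z.2.1)
  · intro h
    have h : (x : ℝ) ≤ y := h
    exact ⟨⟨y - x, by linarith, by linarith [y.2.2, x.2.1]⟩, (add_sub_cancel (x : ℝ) y).trans_le y.2.2,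
      Subtype.ext (add_sub_cancel (x : ℝ) y)⟩

theorem unitInterval_isJoin_iff {S : Set unitInterval} {z : unitInterval} :
    IsJoin S z ↔ IsLUB S z := by
  simp only [IsJoin, unitInterval_le_iff, IsLUB, IsLeast, upperBounds, lowerBounds,
    Set.mem_ofPred_eq]

noncomputable instance instSigmaEffectModuleUnitInterval : SigmaEffectModule unitInterval where
  exists_join S _ := ⟨sSup S, unitInterval_isJoin_iff.2 (isLUB_sSup S)⟩

/-! The Giry monad of probability measures. -/

/-- The functor part of the Giry monad: the push-forward. -/
noncomputable def giryMap {X : Type u} {Y : Type v} [MeasurableSpace X] [MeasurableSpace Y]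
    (f : X → Y) (hf : Measurable f) (μ : ProbabilityMeasure X) : ProbabilityMeasure Y :=
  μ.map hf.aemeasurable

/-- The unit of the Giry monad: the Dirac measure. -/
noncomputable def giryUnit {X : Type u} [MeasurableSpace X] (x : X) : ProbabilityMeasure X :=
  ⟨Measure.dirac x, inferInstance⟩

theorem measurable_toMeasure {X : Type u} [MeasurableSpace X] :
    Measurable (ProbabilityMeasure.toMeasure (Ω := X)) := measurable_subtype_coe

theorem isProbabilityMeasure_giryMult {X : Type u} [MeasurableSpace X]
    (Φ : ProbabilityMeasure (ProbabilityMeasure X)) :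
    IsProbabilityMeasure
      (Measure.join ((Φ : Measure (ProbabilityMeasure X)).map ProbabilityMeasure.toMeasure)) := by
  constructor
  rw [Measure.join_apply MeasurableSet.univ,
    lintegral_map (Measure.measurable_coe MeasurableSet.univ) measurable_toMeasure]
  simp

/-- The multiplication of the Giry monad: `M ↦ ∫ μ(M) dΦ(μ)`. -/
noncomputable def giryMult {X : Type u} [MeasurableSpace X]
    (Φ : ProbabilityMeasure (ProbabilityMeasure X)) : ProbabilityMeasure X :=
  ⟨Measure.join ((Φ : Measure (ProbabilityMeasure X)).map ProbabilityMeasure.toMeasure),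
    isProbabilityMeasure_giryMult Φ⟩

/-- Eilenberg-Moore algebras of the Giry monad. The `σ`-algebra on `ProbabilityMeasure X` is the
smallest one that makes the evaluations `μ ↦ μ(M)` at measurable sets `M` measurable. -/
class GiryAlgebra (X : Type u) [MeasurableSpace X] where
  act : ProbabilityMeasure X → X
  measurable_act : Measurable act
  act_unit : ∀ x : X, act (giryUnit x) = x
  act_mult : ∀ Φ : ProbabilityMeasure (ProbabilityMeasure X),
    act (giryMult Φ) = act (giryMap act measurable_act Φ)

/-- Morphisms of algebras of the Giry monad. -/
structure GiryHom (X : Type u) (Y : Type v) [MeasurableSpace X] [MeasurableSpace Y]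
    [GiryAlgebra X] [GiryAlgebra Y] where
  toFun : X → Y
  measurable : Measurable toFun
  map_act : ∀ μ : ProbabilityMeasure X,
    toFun (GiryAlgebra.act μ) = GiryAlgebra.act (giryMap toFun measurable μ)

theorem GiryHom.ext {X : Type u} {Y : Type v} [MeasurableSpace X] [MeasurableSpace Y]
    [GiryAlgebra X] [GiryAlgebra Y] {f g : GiryHom X Y} (h : ∀ x, f.toFun x = g.toFun x) :
    f = g := by
  cases f; cases g; congr; exact funext h

/-- Isomorphism of algebras of the Giry monad: a pair of mutually inverse morphisms. -/
def GiryAlgebra.Isomorphic (X : Type u) (Y : Type v) [MeasurableSpace X] [MeasurableSpace Y]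
    [GiryAlgebra X] [GiryAlgebra Y] : Prop :=
  ∃ (f : GiryHom X Y) (g : GiryHom Y X),
    (∀ x, g.toFun (f.toFun x) = x) ∧ ∀ y, f.toFun (g.toFun y) = y

/-! Integration of `[0,1]`-valued functions. -/

theorem integral_unitInterval_mem {X : Type u} [MeasurableSpace X] (μ : ProbabilityMeasure X)
    (p : X → unitInterval) : (∫ x, (p x : ℝ) ∂(μ : Measure X)) ∈ unitInterval := by
  refine ⟨integral_nonneg fun x => (p x).2.1, ?_⟩
  have := norm_integral_le_of_norm_le_const (μ := (μ : Measure X)) (f := fun x => (p x : ℝ)) (C := 1)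
    (Filter.Eventually.of_forall fun x => by
      rw [Real.norm_of_nonneg (p x).2.1]; exact (p x).2.2)
  simpa using (Real.le_norm_self _).trans this

/-- The integral `∫ p dμ ∈ [0,1]`; it is used for measurable `p` only. -/
noncomputable def avg {X : Type u} [MeasurableSpace X] (μ : ProbabilityMeasure X)
    (p : X → unitInterval) : unitInterval :=
  ⟨∫ x, (p x : ℝ) ∂(μ : Measure X), integral_unitInterval_mem μ p⟩

section avg

variable {X : Type u} [MeasurableSpace X]

theorem integrable_coe (μ : ProbabilityMeasure X) {p : X → unitInterval} (hp : Measurable p) :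
    Integrable (fun x => (p x : ℝ)) (μ : Measure X) :=
  Integrable.of_bound (C := 1) (measurable_subtype_coe.comp hp).aestronglyMeasurable
    (Filter.Eventually.of_forall fun x => by
      rw [Real.norm_of_nonneg (p x).2.1]; exact (p x).2.2)

theorem ofReal_avg (μ : ProbabilityMeasure X) {p : X → unitInterval} (hp : Measurable p) :
    ENNReal.ofReal (avg μ p) = ∫⁻ x, ENNReal.ofReal (p x) ∂(μ : Measure X) :=
  ofReal_integral_eq_lintegral_ofReal (integrable_coe μ hp)
    (Filter.Eventually.of_forall fun x => (p x).2.1)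

theorem eq_of_ofReal {r s : unitInterval} (h : ENNReal.ofReal r = ENNReal.ofReal s) : r = s :=
  Subtype.ext ((ENNReal.ofReal_eq_ofReal_iff r.2.1 s.2.1).1 h)

theorem avg_mono (μ : ProbabilityMeasure X) {p q : X → unitInterval} (hp : Measurable p)
    (hq : Measurable q) (h : ∀ x, p x ≤ q x) : avg μ p ≤ avg μ q :=
  integral_mono (integrable_coe μ hp) (integrable_coe μ hq) h

theorem avg_unit {p : X → unitInterval} (hp : Measurable p) (x : X) : avg (giryUnit x) p = p x := by
  apply eq_of_ofReal
  rw [ofReal_avg _ hp]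
  exact lintegral_dirac' x (ENNReal.measurable_ofReal.comp (measurable_subtype_coe.comp hp))

theorem avg_map {Y : Type v} [MeasurableSpace Y] {f : X → Y} (hf : Measurable f)
    (μ : ProbabilityMeasure X) {p : Y → unitInterval} (hp : Measurable p) :
    avg (giryMap f hf μ) p = avg μ fun x => p (f x) := by
  apply eq_of_ofReal
  rw [ofReal_avg _ hp, ofReal_avg (p := fun x => p (f x)) _ (hp.comp hf)]
  exact lintegral_map (ENNReal.measurable_ofReal.comp (measurable_subtype_coe.comp hp)) hf

theorem measurable_avg {p : X → unitInterval} (hp : Measurable p) :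
    Measurable fun μ : ProbabilityMeasure X => avg μ p := by
  refine Measurable.subtype_mk ?_
  have h : ∀ μ : ProbabilityMeasure X, ∫ x, (p x : ℝ) ∂(μ : Measure X) =
      (∫⁻ x, ENNReal.ofReal (p x) ∂(μ : Measure X)).toReal := fun μ => by
    rw [← ofReal_avg μ hp, ENNReal.toReal_ofReal (avg μ p).2.1]; rfl
  simp_rw [h]
  exact ENNReal.measurable_toReal.comp ((Measure.measurable_lintegral
    (ENNReal.measurable_ofReal.comp (measurable_subtype_coe.comp hp))).comp measurable_subtype_coe)

theorem avg_mult (Φ : ProbabilityMeasure (ProbabilityMeasure X)) {p : X → unitInterval}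
    (hp : Measurable p) : avg (giryMult Φ) p = avg Φ fun μ => avg μ p := by
  apply eq_of_ofReal
  rw [ofReal_avg _ hp, ofReal_avg _ (measurable_avg hp)]
  have hm := ENNReal.measurable_ofReal.comp (measurable_subtype_coe.comp hp)
  refine (Measure.lintegral_join hm.aemeasurable).trans ?_
  rw [lintegral_map (Measure.measurable_lintegral hm) measurable_toMeasure]
  exact lintegral_congr fun μ => (ofReal_avg μ hp).symm

theorem avg_isLUB (μ : ProbabilityMeasure X) {ι : Type w} [Countable ι]
    {p : ι → X → unitInterval} (hp : ∀ i, Measurable (p i))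
    (hdir : ∀ i j, ∃ k, (∀ x, p i x ≤ p k x) ∧ ∀ x, p j x ≤ p k x)
    {q : X → unitInterval} (hq : ∀ x, IsLUB (Set.range fun i => p i x) (q x)) :
    IsLUB (Set.range fun i => avg μ (p i)) (avg μ q) := by
  have hqm : Measurable q := Measurable.isLUB hp hq
  constructor
  · rintro _ ⟨i, rfl⟩
    exact avg_mono μ (hp i) hqm fun x => (hq x).1 ⟨i, rfl⟩
  · intro c hc
    have key : ∀ x, ENNReal.ofReal (q x) = ⨆ i, ENNReal.ofReal (p i x) := by
      intro x
      apply le_antisymm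
      · have hs : (⨆ i, ENNReal.ofReal (p i x)) ≤ 1 :=
          iSup_le fun i => ENNReal.ofReal_le_one.2 (p i x).2.2
        have hs' : (⨆ i, ENNReal.ofReal (p i x)) ≠ ⊤ := ne_top_of_le_ne_top ENNReal.one_ne_top hs
        let s : unitInterval := ⟨(⨆ i, ENNReal.ofReal (p i x)).toReal, ENNReal.toReal_nonneg,
          ENNReal.toReal_le_of_le_ofReal zero_le_one (by simpa using hs)⟩
        have : q x ≤ s := by
          apply (hq x).2
          rintro _ ⟨i, rfl⟩
          exact (ENNReal.ofReal_le_iff_le_toReal hs').1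
            (le_iSup (fun i => ENNReal.ofReal (p i x : ℝ)) i)
        exact (ENNReal.ofReal_le_iff_le_toReal hs').2 this
      · exact iSup_le fun i => ENNReal.ofReal_le_ofReal ((hq x).1 ⟨i, rfl⟩)
    have hle : ENNReal.ofReal (avg μ q) ≤ ENNReal.ofReal c := by
      rw [ofReal_avg μ hqm]
      simp_rw [key]
      rw [lintegral_iSup_directed_of_measurable (f := fun i x => ENNReal.ofReal (p i x : ℝ))
        (fun i => ENNReal.measurable_ofReal.comp (measurable_subtype_coe.comp (hp i)))]
      · refine iSup_le fun i => ?_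
        have := ofReal_avg μ (hp i)
        refine this.symm.le.trans (ENNReal.ofReal_le_ofReal (hc ⟨i, rfl⟩))
      · intro i j
        obtain ⟨k, h1, h2⟩ := hdir i j
        exact ⟨k, fun x => ENNReal.ofReal_le_ofReal (h1 x),
          fun x => ENNReal.ofReal_le_ofReal (h2 x)⟩
    exact (ENNReal.ofReal_le_ofReal_iff c.2.1).1 hle

theorem coe_avg (μ : ProbabilityMeasure X) (p : X → unitInterval) :
    (avg μ p : ℝ) = ∫ x, (p x : ℝ) ∂(μ : Measure X) := rfl

end avg

/-- The unit interval as an algebra of the Giry monad, `μ ↦ ∫ t dμ(t)`. -/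
noncomputable instance instGiryAlgebraUnitInterval : GiryAlgebra unitInterval where
  act μ := avg μ id
  measurable_act := measurable_avg measurable_id
  act_unit x := avg_unit measurable_id x
  act_mult Φ := by
    rw [avg_mult Φ measurable_id, avg_map _ Φ measurable_id]
    rfl

/-! The algebra of the Giry monad `Hom(E, [0,1])`, for a `σ`-effect module `E`. -/

section Dual

variable {E : Type u} [SigmaEffectModule E]

/-- The smallest `σ`-algebra that makes all evaluations measurable. -/
instance instMeasurableSpaceSigmaHom : MeasurableSpace (SigmaHom E unitInterval) :=
  ⨆ e : E, MeasurableSpace.comap (fun f => f.toFun e) inferInstance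

theorem measurable_eval (e : E) : Measurable fun f : SigmaHom E unitInterval => f.toFun e :=
  Measurable.of_comap_le (le_iSup (fun e : E =>
    MeasurableSpace.comap (fun f : SigmaHom E unitInterval => f.toFun e) inferInstance) e)

theorem measurable_to_sigmaHom {X : Type v} [MeasurableSpace X] {g : X → SigmaHom E unitInterval}
    (h : ∀ e, Measurable fun x => (g x).toFun e) : Measurable g := by
  refine Measurable.of_le_map (iSup_le fun e => ?_)
  rw [MeasurableSpace.comap_le_iff_le_map, MeasurableSpace.map_comp]
  exact h e

theorem mem_oplus_unitInterval {x y z : unitInterval} :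
    z ∈ oplus x y ↔ (x : ℝ) + y = z := by
  constructor
  · rintro ⟨h, rfl⟩; rfl
  · intro h
    exact ⟨h.trans_le z.2.2, Subtype.ext h⟩

theorem SigmaHom.mono (f : SigmaHom E unitInterval) {x y : E} (h : Le x y) :
    f.toFun x ≤ f.toFun y := by
  obtain ⟨z, hz⟩ := h
  exact unitInterval_le_iff.1 ⟨_, f.map_oplus hz⟩

/-- The barycentre `e ↦ ∫ ω(e) dμ(ω)` of a probability measure on `Hom(E, [0,1])`. -/
noncomputable def sigmaHomAct (μ : ProbabilityMeasure (SigmaHom E unitInterval)) :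
    SigmaHom E unitInterval where
  toFun e := avg μ fun f => f.toFun e
  map_oplus := by
    intro x y z h
    rw [mem_oplus_unitInterval, coe_avg, coe_avg, coe_avg,
      ← integral_add (integrable_coe μ (measurable_eval x)) (integrable_coe μ (measurable_eval y))]
    exact integral_congr_ae (Filter.Eventually.of_forall fun f =>
      mem_oplus_unitInterval.1 (f.map_oplus h))
  map_compl x := by
    apply Subtype.ext
    have h : ∀ f : SigmaHom E unitInterval, (f.toFun (compl x) : ℝ) = 1 - f.toFun x := fun f => by
      rw [f.map_compl]; rfl
    refine (coe_avg _ _).trans ?_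
    simp_rw [h]
    rw [integral_sub (integrable_const _) (integrable_coe μ (measurable_eval x))]
    simp
    rfl
  map_zero := by
    apply Subtype.ext
    have h : ∀ f : SigmaHom E unitInterval, (f.toFun zero : ℝ) = 0 := fun f => by
      rw [f.map_zero]; rfl
    refine (coe_avg _ _).trans ?_
    simp_rw [h]
    simp
    rfl
  map_smul r x := by
    apply Subtype.ext
    have h : ∀ f : SigmaHom E unitInterval,
        (f.toFun (EffectModule.smul r x) : ℝ) = r * f.toFun x := fun f => by
      rw [f.map_smul]; rfl
    refine (coe_avg _ _).trans ?_
    simp_rw [h]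
    rw [integral_const_mul]
    rfl
  map_join S z hS hz := by
    rw [unitInterval_isJoin_iff]
    have : Countable S := hS.1.to_subtype
    have := avg_isLUB μ (ι := S) (p := fun e f => f.toFun e) (q := fun f => f.toFun z)
      (fun e => measurable_eval e.1) (fun i j => by
        by_cases hij : (i : E) = j
        · exact ⟨i, fun _ => le_rfl, fun f => by rw [hij]⟩
        · rcases hS.2 i.2 j.2 hij with h | h
          · exact ⟨j, fun f => f.mono h, fun _ => le_rfl⟩
          · exact ⟨i, fun _ => le_rfl, fun f => f.mono h⟩)
      (fun f => by
        have := unitInterval_isJoin_iff.1 (f.map_join S z hS hz)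
        rwa [Set.image_eq_range] at this)
    rwa [Set.image_eq_range]

theorem measurable_sigmaHomAct : Measurable (sigmaHomAct (E := E)) :=
  measurable_to_sigmaHom fun e => measurable_avg (measurable_eval e)

/-- `Hom(E, [0,1])` as an algebra of the Giry monad. -/
noncomputable instance instGiryAlgebraSigmaHom : GiryAlgebra (SigmaHom E unitInterval) where
  act := sigmaHomAct
  measurable_act := measurable_sigmaHomAct
  act_unit f := SigmaHom.ext fun e => avg_unit (measurable_eval e) f
  act_mult Φ := SigmaHom.ext fun e => by
    refine (avg_mult Φ (measurable_eval e)).trans ?_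
    exact (avg_map measurable_sigmaHomAct Φ (measurable_eval e)).symm

end Dual

/-! The `σ`-effect module `Hom(X, [0,1])`, for an algebra `X` of the Giry monad. -/

section Predicates

variable {X : Type u} [MeasurableSpace X] [GiryAlgebra X]

theorem GiryHom.apply_act (f : GiryHom X unitInterval) (μ : ProbabilityMeasure X) :
    f.toFun (GiryAlgebra.act μ) = avg μ f.toFun :=
  (f.map_act μ).trans (avg_map f.measurable μ measurable_id)

/-- A measurable map into `[0,1]` that commutes with integration is a morphism. -/
noncomputable def GiryHom.ofAvg (f : X → unitInterval) (hf : Measurable f)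
    (h : ∀ μ : ProbabilityMeasure X, f (GiryAlgebra.act μ) = avg μ f) :
    GiryHom X unitInterval where
  toFun := f
  measurable := hf
  map_act μ := (h μ).trans (avg_map hf μ measurable_id).symm

/-- The pointwise sum of morphisms into `[0,1]`, where it is bounded by `1`. -/
noncomputable def GiryHom.add (f g : GiryHom X unitInterval)
    (h : ∀ x, (f.toFun x : ℝ) + g.toFun x ≤ 1) : GiryHom X unitInterval :=
  GiryHom.ofAvg (fun x => ⟨(f.toFun x : ℝ) + g.toFun x,
      add_nonneg (f.toFun x).2.1 (g.toFun x).2.1, h x⟩)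
    ((measurable_subtype_coe.comp f.measurable).add
      (measurable_subtype_coe.comp g.measurable)).subtype_mk
    (fun μ => by
      apply Subtype.ext
      simp only [coe_avg, f.apply_act, g.apply_act]
      exact (integral_add (integrable_coe μ f.measurable) (integrable_coe μ g.measurable)).symm)

/-- The pointwise complement `1 - f`. -/
noncomputable def GiryHom.compl (f : GiryHom X unitInterval) : GiryHom X unitInterval :=
  GiryHom.ofAvg (fun x => unitInterval.symm (f.toFun x))
    (unitInterval.continuous_symm.measurable.comp f.measurable)
    (fun μ => by
      apply Subtype.ext
      simp only [coe_avg, f.apply_act, unitInterval.coe_symm_eq]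
      rw [integral_sub (integrable_const _) (integrable_coe μ f.measurable)]
      simp)

/-- The pointwise multiple `r f`. -/
noncomputable def GiryHom.smul (r : unitInterval) (f : GiryHom X unitInterval) :
    GiryHom X unitInterval :=
  GiryHom.ofAvg (fun x => r * f.toFun x)
    (((measurable_subtype_coe.comp f.measurable).const_mul (r : ℝ)).subtype_mk)
    (fun μ => by
      apply Subtype.ext
      simp only [coe_avg, f.apply_act, Set.Icc.coe_mul]
      rw [integral_const_mul])

/-- The zero map. -/
noncomputable def GiryHom.zero : GiryHom X unitInterval :=
  GiryHom.ofAvg (fun _ => 0) measurable_const (fun μ => Subtype.ext (by simp [coe_avg]))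

theorem GiryHom.ext_real {f g : GiryHom X unitInterval}
    (h : ∀ x, (f.toFun x : ℝ) = g.toFun x) : f = g :=
  GiryHom.ext fun x => Subtype.ext (h x)

/-- `Hom(X, [0,1])` with the pointwise operations; `f ⊕ g` is defined iff `f + g ≤ 1`. -/
noncomputable instance instEffectModuleGiryHom : EffectModule (GiryHom X unitInterval) where
  oplus f g := ⟨∀ x, (f.toFun x : ℝ) + g.toFun x ≤ 1, fun h => f.add g h⟩
  compl := GiryHom.compl
  zero := GiryHom.zero
  oplus_comm := by
    rintro f g k ⟨h, rfl⟩
    exact ⟨fun x => by simpa [add_comm] using h x, GiryHom.ext_real fun x => add_comm _ _⟩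
  oplus_assoc := by
    rintro f g k s t ⟨h, rfl⟩ ⟨h', rfl⟩
    have h'' : ∀ x, (f.toFun x : ℝ) + (g.toFun x + k.toFun x) ≤ 1 := h'
    have hk := fun x => (k.toFun x).2.1
    exact ⟨_, ⟨fun x => by linarith [h'' x, hk x], rfl⟩,
      ⟨fun x => (add_assoc _ _ _).trans_le (h'' x), GiryHom.ext_real fun x => add_assoc _ _ _⟩⟩
  oplus_zero f := ⟨fun x => (add_zero _).trans_le (f.toFun x).2.2,
    GiryHom.ext_real fun x => add_zero _⟩
  one_mem_oplus_iff := by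
    intro f g
    constructor
    · rintro ⟨h, h'⟩
      refine GiryHom.ext_real fun x => ?_
      have h1 : (f.toFun x : ℝ) + g.toFun x = 1 - 0 :=
        congrArg (fun k : GiryHom X unitInterval => (k.toFun x : ℝ)) h'
      change (g.toFun x : ℝ) = 1 - f.toFun x
      linarith
    · rintro rfl
      refine ⟨fun x => ?_, GiryHom.ext_real fun x => ?_⟩
      · change (f.toFun x : ℝ) + (1 - f.toFun x) ≤ 1
        linarith
      · change (f.toFun x : ℝ) + (1 - f.toFun x) = 1 - 0
        ring
  eq_zero_of_oplus_one := by
    intro f h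
    refine GiryHom.ext_real fun x => ?_
    have h : (f.toFun x : ℝ) + (1 - 0) ≤ 1 := h x
    have hx := (f.toFun x).2.1
    change (f.toFun x : ℝ) = 0
    linarith
  smul := GiryHom.smul
  smul_smul r s f := GiryHom.ext_real fun x => (mul_assoc (r : ℝ) s (f.toFun x)).symm
  add_smul := by
    intro r s t f h
    have : ∀ x, (r : ℝ) * f.toFun x + s * f.toFun x = t * f.toFun x := fun x => by
      rw [← h]; ring
    exact ⟨fun x => (this x).trans_le (mul_le_one₀ t.2.2 (f.toFun x).2.1 (f.toFun x).2.2),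
      GiryHom.ext_real this⟩
  smul_oplus := by
    rintro r f g k ⟨h, rfl⟩
    have : ∀ x, (r : ℝ) * f.toFun x + r * g.toFun x = r * (f.toFun x + g.toFun x) := fun x => by
      ring
    exact ⟨fun x => (this x).trans_le
        (mul_le_one₀ r.2.2 (add_nonneg (f.toFun x).2.1 (g.toFun x).2.1) (h x)),
      GiryHom.ext_real this⟩
  one_smul f := GiryHom.ext_real fun x => one_mul _

theorem giryHom_le_iff {f g : GiryHom X unitInterval} :
    Le f g ↔ ∀ x, f.toFun x ≤ g.toFun x := by
  constructor
  · rintro ⟨k, h, rfl⟩ x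
    exact Subtype.coe_le_coe.1 (le_add_of_nonneg_right (k.toFun x).2.1)
  · intro h
    have h : ∀ x, (f.toFun x : ℝ) ≤ g.toFun x := h
    refine ⟨GiryHom.ofAvg (fun x => ⟨g.toFun x - f.toFun x, by linarith [h x],
        by linarith [(g.toFun x).2.2, (f.toFun x).2.1]⟩)
      ((measurable_subtype_coe.comp g.measurable).sub
        (measurable_subtype_coe.comp f.measurable)).subtype_mk (fun μ => ?_), fun x => ?_,
        GiryHom.ext_real fun x => ?_⟩
    · apply Subtype.ext
      simp only [coe_avg, f.apply_act, g.apply_act]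
      exact (integral_sub (integrable_coe μ g.measurable) (integrable_coe μ f.measurable)).symm
    · change (f.toFun x : ℝ) + (g.toFun x - f.toFun x) ≤ 1
      linarith [(g.toFun x).2.2]
    · change (f.toFun x : ℝ) + (g.toFun x - f.toFun x) = g.toFun x
      ring

noncomputable instance instSigmaEffectModuleGiryHom :
    SigmaEffectModule (GiryHom X unitInterval) where
  exists_join S hS := by
    have : Countable S := hS.1.to_subtype
    have hlub : ∀ x, IsLUB (Set.range fun f : S => f.1.toFun x)
        (sSup (Set.range fun f : S => f.1.toFun x)) := fun x => isLUB_sSup _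
    refine ⟨GiryHom.ofAvg (fun x => sSup (Set.range fun f : S => f.1.toFun x))
      (Measurable.isLUB (fun f : S => f.1.measurable) hlub) (fun μ => ?_), ?_, ?_⟩
    · have := avg_isLUB μ (ι := S) (p := fun f x => f.1.toFun x) (fun f => f.1.measurable)
        (fun i j => by
          by_cases hij : (i : GiryHom X unitInterval) = j
          · exact ⟨i, fun _ => le_rfl, fun f => by rw [hij]⟩
          · rcases hS.2 i.2 j.2 hij with h | h
            · exact ⟨j, giryHom_le_iff.1 h, fun _ => le_rfl⟩
            · exact ⟨i, fun _ => le_rfl, giryHom_le_iff.1 h⟩) hlub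
      simp_rw [GiryHom.apply_act]
      exact (isLUB_sSup _).unique this
    · intro f hf
      exact giryHom_le_iff.2 fun x => (hlub x).1 ⟨⟨f, hf⟩, rfl⟩
    · intro t ht
      refine giryHom_le_iff.2 fun x => (hlub x).2 ?_
      rintro _ ⟨f, rfl⟩
      exact giryHom_le_iff.1 (ht f.1 f.2) x

end Predicates

/-! Operators on a Hilbert space. -/

section Operators

open scoped InnerProductSpace ComplexOrder

variable {H : Type u} [NormedAddCommGroup H] [InnerProductSpace ℂ H]

theorem op_le_iff {A B : H →L[ℂ] H} : A ≤ B ↔ ∀ x, ⟪x, A x⟫_ℂ ≤ ⟪x, B x⟫_ℂ := by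
  rw [ContinuousLinearMap.le_def]
  constructor
  · intro h x
    have := h.inner_nonneg_right x
    rwa [_root_.sub_apply, inner_sub_right, sub_nonneg] at this
  · intro h
    rw [ContinuousLinearMap.isPositive_iff_complex]
    intro x
    have h1 : 0 ≤ ⟪x, (B - A) x⟫_ℂ := by
      rw [_root_.sub_apply, inner_sub_right, sub_nonneg]
      exact h x
    have h2 : ⟪(B - A) x, x⟫_ℂ = ⟪x, (B - A) x⟫_ℂ := by
      rw [← inner_conj_symm]
      exact Complex.conj_eq_iff_im.2 (Complex.nonneg_iff.1 h1).2.symm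
    rw [h2]
    exact ⟨Complex.ext rfl (Complex.nonneg_iff.1 h1).2, (Complex.nonneg_iff.1 h1).1⟩

theorem op_nonneg_iff {A : H →L[ℂ] H} : 0 ≤ A ↔ ∀ x, 0 ≤ ⟪x, A x⟫_ℂ := by
  simp [op_le_iff]

theorem op_ext {A B : H →L[ℂ] H} (h : ∀ x, ⟪x, A x⟫_ℂ = ⟪x, B x⟫_ℂ) : A = B :=
  le_antisymm (op_le_iff.2 fun x => (h x).le) (op_le_iff.2 fun x => (h x).ge)

theorem norm_op_le_one [CompleteSpace H] {A : H →L[ℂ] H} (h0 : 0 ≤ A) (h1 : A ≤ 1) : ‖A‖ ≤ 1 :=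
  (CStarAlgebra.norm_le_one_iff_of_nonneg A h0).2 h1

theorem norm_inner_op_le {A : H →L[ℂ] H} (h : ‖A‖ ≤ 1) (x y : H) : ‖⟪x, A y⟫_ℂ‖ ≤ ‖x‖ * ‖y‖ :=
  (norm_inner_le_norm x (A y)).trans
    (mul_le_mul_of_nonneg_left ((A.le_opNorm y).trans
      (mul_le_of_le_one_left (norm_nonneg y) h)) (norm_nonneg x))

/-- A bounded sesquilinear form is given by an operator. -/
theorem exists_op_of_form [CompleteSpace H] (B : H → H → ℂ)
    (add_left : ∀ x x' y, B (x + x') y = B x y + B x' y)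
    (smul_left : ∀ (c : ℂ) x y, B (c • x) y = star c * B x y)
    (add_right : ∀ x y y', B x (y + y') = B x y + B x y')
    (smul_right : ∀ (c : ℂ) x y, B x (c • y) = c * B x y)
    (bound : ∀ x y, ‖B x y‖ ≤ ‖x‖ * ‖y‖) :
    ∃ A : H →L[ℂ] H, ∀ x y, ⟪x, A y⟫_ℂ = B x y := by
  let f : H →ₗ⋆[ℂ] H →ₗ[ℂ] ℂ := LinearMap.mk₂'ₛₗ _ _ B add_left smul_left add_right smul_right
  let F := f.mkContinuous₂ 1 (fun x y => by rw [one_mul]; exact bound x y)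
  refine ⟨ContinuousLinearMap.adjoint (InnerProductSpace.continuousLinearMapOfBilin F),
    fun x y => ?_⟩
  rw [ContinuousLinearMap.adjoint_inner_right, InnerProductSpace.continuousLinearMapOfBilin_apply]
  rfl

end Operators

/-! Effects. -/

section Effects

open scoped InnerProductSpace ComplexOrder

/-- The effects on `H`: the operators `A` with `0 ≤ A ≤ 1`. -/
structure Effect (H : Type u) [NormedAddCommGroup H] [InnerProductSpace ℂ H] where
  op : H →L[ℂ] H
  nonneg : 0 ≤ op
  le_one : op ≤ 1

variable {H : Type u} [NormedAddCommGroup H] [InnerProductSpace ℂ H]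

theorem Effect.ext {A B : Effect H} (h : A.op = B.op) : A = B := by
  cases A; cases B; congr

theorem real_smul_op_mono {r : ℝ} (hr : 0 ≤ r) {A B : H →L[ℂ] H} (h : A ≤ B) :
    (r : ℂ) • A ≤ (r : ℂ) • B := by
  rw [op_le_iff] at h ⊢
  intro x
  simp only [_root_.smul_apply, inner_smul_right]
  exact mul_le_mul_of_nonneg_left (h x) (by exact_mod_cast hr)

theorem real_smul_op_le_one (r : unitInterval) {A : H →L[ℂ] H} (h : A ≤ 1) :
    ((r : ℝ) : ℂ) • A ≤ 1 := by
  refine (real_smul_op_mono r.2.1 h).trans (op_le_iff.2 fun x => ?_)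
  simp only [_root_.smul_apply, inner_smul_right]
  have h2 : 0 ≤ ⟪x, (1 : H →L[ℂ] H) x⟫_ℂ :=
    ContinuousLinearMap.isPositive_one.inner_nonneg_right x
  exact mul_le_of_le_one_left h2 (by exact_mod_cast r.2.2)

variable [CompleteSpace H]

/-- The effect module of effects: `A ⊕ B` is `A + B`, defined iff `A + B ≤ 1`, and the
orthocomplement of `A` is `1 - A`. -/
noncomputable instance instEffectModuleEffect : EffectModule (Effect H) where
  oplus A B := ⟨A.op + B.op ≤ 1, fun h => ⟨A.op + B.op, add_nonneg A.nonneg B.nonneg, h⟩⟩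
  compl A := ⟨1 - A.op, sub_nonneg.2 A.le_one, sub_le_self _ A.nonneg⟩
  zero := ⟨0, le_rfl, ContinuousLinearMap.nonneg_iff_isPositive _ |>.2
    ContinuousLinearMap.isPositive_one⟩
  oplus_comm := by
    rintro A B C ⟨h, rfl⟩
    exact ⟨(add_comm _ _).trans_le h, Effect.ext (add_comm _ _)⟩
  oplus_assoc := by
    rintro A B C S T ⟨h, rfl⟩ ⟨h', rfl⟩
    have h'' : A.op + (B.op + C.op) ≤ 1 := h'
    rw [← add_assoc] at h''
    exact ⟨_, ⟨(le_add_of_nonneg_right C.nonneg).trans h'', rfl⟩,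
      ⟨h'', Effect.ext (add_assoc _ _ _)⟩⟩
  oplus_zero A := ⟨(add_zero _).trans_le A.le_one, Effect.ext (add_zero _)⟩
  one_mem_oplus_iff := by
    intro A B
    constructor
    · rintro ⟨h, h'⟩
      have h1 : A.op + B.op = 1 - 0 := congrArg Effect.op h'
      refine Effect.ext ?_
      change B.op = 1 - A.op
      rw [sub_zero] at h1
      rw [← h1, add_sub_cancel_left]
    · rintro rfl
      refine ⟨(add_sub_cancel A.op 1).le, Effect.ext ?_⟩
      change A.op + (1 - A.op) = 1 - 0
      rw [add_sub_cancel, sub_zero]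
  eq_zero_of_oplus_one := by
    intro A h
    have h : A.op + (1 - 0) ≤ 1 := h
    rw [sub_zero] at h
    exact Effect.ext (le_antisymm (le_of_add_le_add_right (h.trans_eq (zero_add 1).symm)) A.nonneg)
  smul r A := ⟨((r : ℝ) : ℂ) • A.op, by simpa using real_smul_op_mono r.2.1 A.nonneg,
    real_smul_op_le_one r A.le_one⟩
  smul_smul r s A := Effect.ext (by
    simp only [smul_smul, Set.Icc.coe_mul, Complex.ofReal_mul])
  add_smul := by
    intro r s t A h
    have : ((r : ℝ) : ℂ) • A.op + ((s : ℝ) : ℂ) • A.op = ((t : ℝ) : ℂ) • A.op := by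
      rw [← add_smul, ← h]; push_cast; rfl
    exact ⟨this.trans_le (real_smul_op_le_one t A.le_one), Effect.ext this⟩
  smul_oplus := by
    rintro r A B C ⟨h, rfl⟩
    have : ((r : ℝ) : ℂ) • A.op + ((r : ℝ) : ℂ) • B.op = ((r : ℝ) : ℂ) • (A.op + B.op) :=
      (smul_add _ _ _).symm
    exact ⟨this.trans_le (real_smul_op_le_one r h), Effect.ext this⟩
  one_smul A := Effect.ext (by simp)

theorem effect_le_iff {A B : Effect H} : Le A B ↔ A.op ≤ B.op := by
  constructor
  · rintro ⟨C, h, rfl⟩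
    exact le_add_of_nonneg_right C.nonneg
  · intro h
    exact ⟨⟨B.op - A.op, sub_nonneg.2 h, (sub_le_self B.op A.nonneg).trans B.le_one⟩,
      (add_sub_cancel A.op B.op).trans_le B.le_one, Effect.ext (add_sub_cancel A.op B.op)⟩

theorem exists_limit_op {ι : Type v} (U : Ultrafilter ι) (A : ι → H →L[ℂ] H)
    (hA : ∀ i, ‖A i‖ ≤ 1) :
    ∃ T : H →L[ℂ] H, ∀ x y, Filter.Tendsto (fun i => ⟪x, A i y⟫_ℂ) U (nhds ⟪x, T y⟫_ℂ) := by
  have h : ∀ x y, ∃ c, ‖c‖ ≤ ‖x‖ * ‖y‖ ∧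
      Filter.Tendsto (fun i => ⟪x, A i y⟫_ℂ) U (nhds c) := by
    intro x y
    obtain ⟨c, hc, hlim⟩ := (isCompact_closedBall (0 : ℂ) (‖x‖ * ‖y‖)).ultrafilter_le_nhds'
      (U.map fun i => ⟪x, A i y⟫_ℂ)
      (Filter.mem_map.2 (Filter.univ_mem' fun i => by
        simpa using norm_inner_op_le (hA i) x y))
    exact ⟨c, by simpa using hc, hlim⟩
  choose B hb hB using h
  obtain ⟨T, hT⟩ := exists_op_of_form B
    (fun x x' y => tendsto_nhds_unique (hB _ _)
      (((hB x y).add (hB x' y)).congr fun i => (inner_add_left _ _ _).symm))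
    (fun c x y => tendsto_nhds_unique (hB _ _)
      (((hB x y).const_mul (star c)).congr fun i => (inner_smul_left _ _ _).symm))
    (fun x y y' => tendsto_nhds_unique (hB _ _)
      (((hB x y).add (hB x y')).congr fun i => by rw [map_add, inner_add_right]))
    (fun c x y => tendsto_nhds_unique (hB _ _)
      (((hB x y).const_mul c).congr fun i => by rw [map_smul, inner_smul_right])) hb
  exact ⟨T, fun x y => by rw [hT]; exact hB x y⟩

noncomputable instance instSigmaEffectModuleEffect :
    SigmaEffectModule (Effect H) where
  exists_join S hS := by
    rcases S.eq_empty_or_nonempty with rfl | hne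
    · refine ⟨zero, by simp, fun t _ => ⟨t, oplus_comm (oplus_zero t)⟩⟩
    · have : Nonempty S := hne.to_subtype
      let _ : Preorder S := Preorder.lift fun A : S => A.1.op
      have hdir : IsDirectedOrder S := ⟨fun A B => by
        by_cases hAB : A.1 = B.1
        · exact ⟨A, le_rfl, (Subtype.ext hAB : A = B) ▸ le_rfl⟩
        · rcases hS.2 A.2 B.2 hAB with h | h
          · exact ⟨B, effect_le_iff.1 h, le_rfl⟩
          · exact ⟨A, le_rfl, effect_le_iff.1 h⟩⟩
      let U : Ultrafilter S := Ultrafilter.of Filter.atTop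
      have hU : (U : Filter S) ≤ Filter.atTop := Ultrafilter.of_le _
      obtain ⟨T, hT⟩ := exists_limit_op U (fun A : S => A.1.op)
        fun A => norm_op_le_one A.1.nonneg A.1.le_one
      have hub : ∀ A ∈ S, A.op ≤ T := fun A hA => op_le_iff.2 fun x =>
        ge_of_tendsto (hT x x) ((Filter.eventually_ge_atTop (⟨A, hA⟩ : S)).filter_mono hU |>.mono
          fun B hB => op_le_iff.1 hB x)
      have hlub : ∀ B : H →L[ℂ] H, (∀ A ∈ S, A.op ≤ B) → T ≤ B := fun B hB => op_le_iff.2 fun x =>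
        le_of_tendsto (hT x x) (Filter.Eventually.of_forall fun A => op_le_iff.1 (hB A.1 A.2) x)
      obtain ⟨A, hA⟩ := hne
      exact ⟨⟨T, A.nonneg.trans (hub A hA), hlub 1 fun B _ => B.le_one⟩,
        fun B hB => effect_le_iff.2 (hub B hB),
        fun t ht => effect_le_iff.2 (hlub t.op fun B hB => effect_le_iff.1 (ht B hB))⟩

end Effects

/-! Density matrices. -/

section DensityMatrices

open scoped InnerProductSpace ComplexOrder

/-- The density matrices on `H`: the positive operators of trace `1`, where the trace is the sum of
the diagonal entries with respect to every orthonormal basis. -/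
structure DensityMatrix (H : Type u) [NormedAddCommGroup H] [InnerProductSpace ℂ H] where
  op : H →L[ℂ] H
  nonneg : 0 ≤ op
  trace_eq_one : ∀ (ι : Type u) (b : HilbertBasis ι ℂ H),
    HasSum (fun i => ⟪b i, op (b i)⟫_ℂ) 1

variable {H : Type u} [NormedAddCommGroup H] [InnerProductSpace ℂ H]

theorem DensityMatrix.ext {ρ σ : DensityMatrix H} (h : ρ.op = σ.op) : ρ = σ := by
  cases ρ; cases σ; congr

/-- The topology induced by the weak operator topology. -/
noncomputable instance instTopologicalSpaceDensityMatrix : TopologicalSpace (DensityMatrix H) :=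
  TopologicalSpace.induced (fun ρ => ContinuousLinearMapWOT.ofCLM ρ.op)
    (inferInstance : TopologicalSpace (H →WOT[ℂ] H))

/-- The Borel `σ`-algebra of the weak operator topology. -/
noncomputable instance instMeasurableSpaceDensityMatrix : MeasurableSpace (DensityMatrix H) :=
  borel (DensityMatrix H)

instance instBorelSpaceDensityMatrix : BorelSpace (DensityMatrix H) := ⟨rfl⟩

theorem countable_of_hilbertBasis [TopologicalSpace.SeparableSpace H] {ι : Type u}
    (b : HilbertBasis ι ℂ H) : Countable ι := by
  have hd : ∀ i j, i ≠ j → 1 ≤ ‖b i - b j‖ := by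
    intro i j hij
    have h1 : ‖b i - b j‖ * ‖b i - b j‖ = 1 + 1 := by
      rw [@norm_sub_mul_self ℂ, b.orthonormal.1 i, b.orthonormal.1 j, b.orthonormal.2 hij]
      simp
    nlinarith [norm_nonneg (b i - b j)]
  have hdis : (Set.univ : Set ι).PairwiseDisjoint fun i => Metric.ball (b i) (1 / 2) := by
    intro i _ j _ hij
    refine Metric.ball_disjoint_ball ?_
    rw [dist_eq_norm]
    linarith [hd i j hij]
  exact Set.countable_univ_iff.1 (hdis.countable_of_isOpen (fun i _ => Metric.isOpen_ball)
    fun i _ => ⟨b i, Metric.mem_ball_self (by norm_num)⟩)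

variable [CompleteSpace H]

theorem DensityMatrix.continuous_inner (x y : H) :
    Continuous fun ρ : DensityMatrix H => ⟪x, ρ.op y⟫_ℂ :=
  (ContinuousLinearMapWOT.continuous_dual_apply (σ := RingHom.id ℂ) (F := H) y
    (InnerProductSpace.toDual ℂ H x)).comp
    (continuous_induced_dom (f := fun ρ : DensityMatrix H => ContinuousLinearMapWOT.ofCLM ρ.op))

theorem DensityMatrix.measurable_inner (x y : H) :
    Measurable fun ρ : DensityMatrix H => ⟪x, ρ.op y⟫_ℂ :=
  (DensityMatrix.continuous_inner x y).measurable

theorem DensityMatrix.inner_le_of_norm_eq_one (ρ : DensityMatrix H) {x : H} (hx : ‖x‖ = 1) :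
    ⟪x, ρ.op x⟫_ℂ ≤ 1 := by
  have ho : Orthonormal ℂ ((↑) : ({x} : Set H) → H) := by
    constructor
    · rintro ⟨y, hy⟩
      obtain rfl := Set.mem_singleton_iff.1 hy
      exact hx
    · intro i j hij
      exact absurd (Subsingleton.elim i j) hij
  obtain ⟨w, b, hw, hb⟩ := ho.exists_hilbertBasis_extension
  have h := ρ.trace_eq_one w b
  have := le_hasSum h ⟨x, hw rfl⟩ fun i _ => op_nonneg_iff.1 ρ.nonneg (b i)
  rwa [hb] at this

theorem DensityMatrix.le_one (ρ : DensityMatrix H) : ρ.op ≤ 1 := by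
  refine op_le_iff.2 fun x => ?_
  by_cases hx : x = 0
  · simp [hx]
  have hn : ‖x‖ ≠ 0 := norm_ne_zero_iff.2 hx
  have h1 := ρ.inner_le_of_norm_eq_one (x := ((‖x‖⁻¹ : ℝ) : ℂ) • x) (by
    rw [norm_smul]; simp [hn])
  rw [map_smul, inner_smul_left, inner_smul_right, Complex.conj_ofReal, ← mul_assoc,
    ← Complex.ofReal_mul] at h1
  have h2 : (0 : ℂ) ≤ ((‖x‖ * ‖x‖ : ℝ) : ℂ) := by
    exact_mod_cast mul_self_nonneg ‖x‖
  have h3 := mul_le_mul_of_nonneg_left h1 h2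
  rw [← mul_assoc, ← Complex.ofReal_mul] at h3
  have h4 : ‖x‖ * ‖x‖ * (‖x‖⁻¹ * ‖x‖⁻¹) = 1 := by field_simp
  rw [h4, Complex.ofReal_one, one_mul, mul_one] at h3
  refine h3.trans_eq ?_
  change _ = ⟪x, x⟫_ℂ
  rw [inner_self_eq_norm_sq_to_K, Complex.ofReal_mul, sq]
  rfl

theorem DensityMatrix.norm_le_one (ρ : DensityMatrix H) : ‖ρ.op‖ ≤ 1 :=
  norm_op_le_one ρ.nonneg ρ.le_one

theorem DensityMatrix.integrable_inner (μ : ProbabilityMeasure (DensityMatrix H)) (x y : H) :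
    Integrable (fun ρ : DensityMatrix H => ⟪x, ρ.op y⟫_ℂ) (μ : Measure (DensityMatrix H)) :=
  Integrable.of_bound (C := ‖x‖ * ‖y‖)
    (DensityMatrix.measurable_inner x y).aestronglyMeasurable
    (Filter.Eventually.of_forall fun ρ => norm_inner_op_le ρ.norm_le_one x y)

theorem DensityMatrix.exists_integral (μ : ProbabilityMeasure (DensityMatrix H)) :
    ∃ T : H →L[ℂ] H, ∀ x y, ⟪x, T y⟫_ℂ = ∫ ρ, ⟪x, ρ.op y⟫_ℂ ∂(μ : Measure (DensityMatrix H)) := by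
  apply exists_op_of_form
  · intro x x' y
    simp_rw [inner_add_left]
    exact integral_add (integrable_inner μ x y) (integrable_inner μ x' y)
  · intro c x y
    simp_rw [inner_smul_left]
    exact integral_const_mul _ _
  · intro x y y'
    simp_rw [map_add, inner_add_right]
    exact integral_add (integrable_inner μ x y) (integrable_inner μ x y')
  · intro c x y
    simp_rw [map_smul, inner_smul_right]
    exact integral_const_mul _ _
  · intro x y
    refine (norm_integral_le_of_norm_le_const (Filter.Eventually.of_forall fun ρ =>
      norm_inner_op_le ρ.norm_le_one x y)).trans_eq ?_
    simp

theorem integral_complex_of_nonneg {X : Type v} [MeasurableSpace X] (μ : Measure X) {f : X → ℂ}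
    (h : ∀ x, 0 ≤ f x) : 0 ≤ ∫ x, f x ∂μ := by
  have : ∀ x, f x = (((f x).re : ℝ) : ℂ) := fun x =>
    Complex.ext rfl (Complex.nonneg_iff.1 (h x)).2.symm
  rw [integral_congr_ae (Filter.Eventually.of_forall this)]
  refine le_of_le_of_eq ?_ (integral_ofReal (𝕜 := ℂ) (f := fun x => (f x).re)).symm
  have h2 : 0 ≤ ∫ x, (f x).re ∂μ := integral_nonneg fun x => (Complex.nonneg_iff.1 (h x)).1
  exact Complex.zero_le_real.2 h2

/-- The value `⟪x, ρ x⟫` for a vector `x` in the unit ball. -/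
noncomputable def DensityMatrix.form (x : H) (hx : ‖x‖ ≤ 1) (ρ : DensityMatrix H) : unitInterval :=
  ⟨(⟪x, ρ.op x⟫_ℂ).re, (Complex.nonneg_iff.1 (op_nonneg_iff.1 ρ.nonneg x)).1,
    (Complex.re_le_norm _).trans ((norm_inner_op_le ρ.norm_le_one x x).trans
      (mul_le_one₀ hx (norm_nonneg x) hx))⟩

theorem DensityMatrix.measurable_form (x : H) (hx : ‖x‖ ≤ 1) :
    Measurable (DensityMatrix.form x hx) :=
  (Complex.measurable_re.comp (DensityMatrix.measurable_inner x x)).subtype_mk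

theorem DensityMatrix.ext_form {ρ σ : DensityMatrix H}
    (h : ∀ x hx, DensityMatrix.form x hx ρ = DensityMatrix.form x hx σ) : ρ = σ := by
  refine DensityMatrix.ext (op_ext fun x => ?_)
  have key : ∀ y : H, ‖y‖ ≤ 1 → ⟪y, ρ.op y⟫_ℂ = ⟪y, σ.op y⟫_ℂ := fun y hy =>
    Complex.ext (congrArg Subtype.val (h y hy))
      ((Complex.nonneg_iff.1 (op_nonneg_iff.1 ρ.nonneg y)).2.symm.trans
        (Complex.nonneg_iff.1 (op_nonneg_iff.1 σ.nonneg y)).2)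
  by_cases hx : x = 0
  · simp [hx]
  have hn : ‖x‖ ≠ 0 := norm_ne_zero_iff.2 hx
  have h1 := key (((‖x‖⁻¹ : ℝ) : ℂ) • x) (by rw [norm_smul]; simp [hn])
  simp only [map_smul, inner_smul_left, inner_smul_right] at h1
  simpa [hn] using h1

variable [TopologicalSpace.SeparableSpace H]

theorem DensityMatrix.hasSum_integral (μ : ProbabilityMeasure (DensityMatrix H)) {ι : Type u}
    (b : HilbertBasis ι ℂ H) :
    HasSum (fun i => ∫ ρ, ⟪b i, ρ.op (b i)⟫_ℂ ∂(μ : Measure (DensityMatrix H))) 1 := by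
  have := countable_of_hilbertBasis b
  have hnorm : ∀ (ρ : DensityMatrix H) i,
      ((‖⟪b i, ρ.op (b i)⟫_ℂ‖ : ℝ) : ℂ) = ⟪b i, ρ.op (b i)⟫_ℂ := fun ρ i =>
    (Complex.eq_coe_norm_of_nonneg (op_nonneg_iff.1 ρ.nonneg (b i))).symm
  have hsum : ∀ ρ : DensityMatrix H, HasSum (fun i => ‖⟪b i, ρ.op (b i)⟫_ℂ‖) 1 := fun ρ => by
    have h := ρ.trace_eq_one ι b
    rw [funext fun i => (hnorm ρ i).symm, ← Complex.ofReal_one] at h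
    exact Complex.hasSum_ofReal.1 h
  have := hasSum_integral_of_dominated_convergence (μ := (μ : Measure (DensityMatrix H)))
    (F := fun i ρ => ⟪b i, ρ.op (b i)⟫_ℂ) (f := fun _ => 1)
    (fun i ρ => ‖⟪b i, ρ.op (b i)⟫_ℂ‖)
    (fun i => (DensityMatrix.measurable_inner (b i) (b i)).aestronglyMeasurable)
    (fun i => Filter.Eventually.of_forall fun ρ => le_rfl)
    (Filter.Eventually.of_forall fun ρ => (hsum ρ).summable)
    (by simp_rw [fun ρ => (hsum ρ).tsum_eq]; exact integrable_const _)
    (Filter.Eventually.of_forall fun ρ => ρ.trace_eq_one ι b)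
  simpa using this

/-- The barycentre `∫ ρ dμ(ρ)` of a probability measure on the density matrices; it is determined by
`⟪x, (∫ ρ dμ) y⟫ = ∫ ⟪x, ρ y⟫ dμ`, see `DensityMatrix.inner_act`. -/
noncomputable def DensityMatrix.act (μ : ProbabilityMeasure (DensityMatrix H)) :
    DensityMatrix H where
  op := (DensityMatrix.exists_integral μ).choose
  nonneg := op_nonneg_iff.2 fun x => by
    rw [(DensityMatrix.exists_integral μ).choose_spec]
    exact integral_complex_of_nonneg _ fun ρ => op_nonneg_iff.1 ρ.nonneg x
  trace_eq_one ι b := by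
    simp_rw [(DensityMatrix.exists_integral μ).choose_spec]
    exact DensityMatrix.hasSum_integral μ b

theorem DensityMatrix.inner_act (μ : ProbabilityMeasure (DensityMatrix H)) (x y : H) :
    ⟪x, (DensityMatrix.act μ).op y⟫_ℂ =
      ∫ ρ, ⟪x, ρ.op y⟫_ℂ ∂(μ : Measure (DensityMatrix H)) :=
  (DensityMatrix.exists_integral μ).choose_spec x y

/-- The matrix entries with respect to a dense sequence induce the topology. -/
theorem DensityMatrix.topology_eq : (instTopologicalSpaceDensityMatrix (H := H)) =
    TopologicalSpace.induced (fun ρ (p : ℕ × ℕ) =>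
      ⟪TopologicalSpace.denseSeq H p.1, ρ.op (TopologicalSpace.denseSeq H p.2)⟫_ℂ)
      Pi.topologicalSpace := by
  apply le_antisymm
  · rw [← continuous_iff_le_induced]
    exact continuous_pi fun p => DensityMatrix.continuous_inner _ _
  · let d := TopologicalSpace.denseSeq H
    have hd : DenseRange d := TopologicalSpace.denseRange_denseSeq H
    let t : TopologicalSpace (DensityMatrix H) := TopologicalSpace.induced
      (fun ρ (p : ℕ × ℕ) => ⟪d p.1, ρ.op (d p.2)⟫_ℂ) Pi.topologicalSpace
    have hc : ∀ i j, @Continuous _ _ t _ (fun ρ : DensityMatrix H => ⟪d i, ρ.op (d j)⟫_ℂ) :=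
      fun i j => @Continuous.comp _ _ _ t _ _
        (fun ρ (p : ℕ × ℕ) => ⟪d p.1, ρ.op (d p.2)⟫_ℂ) (fun F => F (i, j))
        (continuous_apply (A := fun _ : ℕ × ℕ => ℂ) (i, j)) continuous_induced_dom
    have hall : ∀ x y : H, @Continuous _ _ t _ (fun ρ : DensityMatrix H => ⟪x, ρ.op y⟫_ℂ) := by
      intro x y
      refine @continuous_of_uniform_approx_of_continuous _ _ t _ _ fun u hu => ?_
      obtain ⟨ε, hε, hεu⟩ := Metric.mem_uniformity_dist.1 hu
      have hlim : Filter.Tendsto (fun p : H × H => ‖x - p.1‖ * ‖y‖ + ‖p.1‖ * ‖y - p.2‖)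
          (nhds (x, y)) (nhds 0) := by
        have : Continuous fun p : H × H => ‖x - p.1‖ * ‖y‖ + ‖p.1‖ * ‖y - p.2‖ := by fun_prop
        simpa using this.tendsto (x, y)
      obtain ⟨⟨i, j⟩, hij⟩ := (hd.prodMap hd).exists_mem_open
        (isOpen_lt (f := fun p : H × H => ‖x - p.1‖ * ‖y‖ + ‖p.1‖ * ‖y - p.2‖)
          (g := fun _ => ε) (by fun_prop) (by fun_prop)) ⟨(x, y), by simpa using hε⟩
      refine ⟨_, hc i j, fun ρ => hεu ?_⟩
      rw [dist_eq_norm]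
      have : ⟪x, ρ.op y⟫_ℂ - ⟪d i, ρ.op (d j)⟫_ℂ =
          ⟪x - d i, ρ.op y⟫_ℂ + ⟪d i, ρ.op (y - d j)⟫_ℂ := by
        rw [inner_sub_left, map_sub, inner_sub_right]; ring
      rw [this]
      exact ((norm_add_le _ _).trans (add_le_add (norm_inner_op_le ρ.norm_le_one _ _)
        (norm_inner_op_le ρ.norm_le_one _ _))).trans_lt hij
    have : @Continuous _ _ t _ (fun ρ : DensityMatrix H => ContinuousLinearMapWOT.ofCLM ρ.op) := by
      let _ := t
      refine ContinuousLinearMapWOT.continuous_of_dual_apply_continuous fun y f => ?_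
      have := hall ((InnerProductSpace.toDual ℂ H).symm f) y
      simpa using this
    exact continuous_iff_le_induced.1 this

theorem DensityMatrix.measurable_of_inner {X : Type v} [MeasurableSpace X]
    {g : X → DensityMatrix H} (h : ∀ x y, Measurable fun a => ⟪x, (g a).op y⟫_ℂ) :
    Measurable g := by
  have : (instMeasurableSpaceDensityMatrix (H := H)) = MeasurableSpace.comap (fun ρ (p : ℕ × ℕ) =>
      ⟪TopologicalSpace.denseSeq H p.1, ρ.op (TopologicalSpace.denseSeq H p.2)⟫_ℂ)
      MeasurableSpace.pi := by
    rw [instMeasurableSpaceDensityMatrix, DensityMatrix.topology_eq, borel_comap,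
      (inferInstance : BorelSpace (ℕ × ℕ → ℂ)).measurable_eq]
  rw [this, measurable_comap_iff]
  exact measurable_pi_iff.2 fun p => h _ _

theorem DensityMatrix.form_act (x : H) (hx : ‖x‖ ≤ 1) (μ : ProbabilityMeasure (DensityMatrix H)) :
    DensityMatrix.form x hx (DensityMatrix.act μ) = avg μ (DensityMatrix.form x hx) := by
  apply Subtype.ext
  change (⟪x, (DensityMatrix.act μ).op x⟫_ℂ).re = _
  rw [DensityMatrix.inner_act]
  exact (integral_re (DensityMatrix.integrable_inner μ x x)).symm

theorem DensityMatrix.measurable_act : Measurable (DensityMatrix.act (H := H)) := by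
  refine DensityMatrix.measurable_of_inner fun x y => ?_
  simp_rw [DensityMatrix.inner_act]
  let η : ProbabilityTheory.Kernel (ProbabilityMeasure (DensityMatrix H)) (DensityMatrix H) :=
    ⟨ProbabilityMeasure.toMeasure, measurable_toMeasure⟩
  exact (StronglyMeasurable.integral_kernel (κ := η)
    (DensityMatrix.measurable_inner x y).stronglyMeasurable).measurable

/-- The density matrices as an algebra of the Giry monad. -/
noncomputable instance instGiryAlgebraDensityMatrix : GiryAlgebra (DensityMatrix H) where
  act := DensityMatrix.act
  measurable_act := DensityMatrix.measurable_act
  act_unit ρ := DensityMatrix.ext_form fun x hx => by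
    rw [DensityMatrix.form_act, avg_unit (DensityMatrix.measurable_form x hx)]
  act_mult Φ := DensityMatrix.ext_form fun x hx => by
    rw [DensityMatrix.form_act, DensityMatrix.form_act,
      avg_mult Φ (DensityMatrix.measurable_form x hx),
      avg_map _ Φ (DensityMatrix.measurable_form x hx)]
    simp_rw [DensityMatrix.form_act]

end DensityMatrices

end EffectDuality

/-! Both isomorphisms come from the pairing `(ρ, A) ↦ tr (ρ A)`. What has to be shown is that every
morphism, on either side, is represented by an operator. Both cases rest on one argument,
`exists_effect_of_affine`, a Gleason-type theorem for affine functions. Given an affine `f` from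
density matrices to `[0,1]`, put `q u = ‖u‖² f(ρ_u)` with `ρ_u` the pure state of `u`. The operator
identity `|x⟩⟨x| + |y⟩⟨y| = (|x+y⟩⟨x+y| + |x-y⟩⟨x-y|) / 2` exhibits a single density matrix as two
different mixtures, so affinity of `f` gives the parallelogram law for `q`. By the Jordan–von
Neumann argument `q` is the quadratic form of an effect (`exists_effect_of_quadratic`).

This settles the pure states, and countable additivity does the rest. A morphism `ω` on effects
preserves joins of chains, hence sums of series of effects (`SigmaHom.hasSum`). Summing the
projections onto a countable orthonormal basis shows that the representing operator has trace one.
Every effect is a sum of rank-one effects (`exists_rankOne_decomposition`, via the square root), so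
`ω` is determined by its values on these. Dually, a Giry morphism `φ` commutes with barycentres of
discrete measures, hence with countable mixtures (`GiryHom.hasSum_of_mixture`), and every density
matrix is a countable mixture of pure states.

Separability enters through the countability of orthonormal bases and through the description of the
Borel structure by countably many matrix entries. -/

namespace EffectDuality

open MeasureTheory EffectAlgebra InnerProductSpace
open scoped InnerProductSpace ComplexOrder

/-! Bounded quadratic forms. -/

section QuadraticForms

variable {H : Type u} [NormedAddCommGroup H] [InnerProductSpace ℂ H]

/-- The polarization of a function, its associated bilinear form if it is a quadratic form. -/
noncomputable def polarize (q : H → ℝ) (x y : H) : ℝ := (q (x + y) - q (x - y)) / 4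

variable {q : H → ℝ}

theorem quadratic_zero (hs : ∀ (c : ℂ) x, q (c • x) = ‖c‖ ^ 2 * q x) : q 0 = 0 := by
  simpa using hs 0 0

theorem quadratic_neg (hs : ∀ (c : ℂ) x, q (c • x) = ‖c‖ ^ 2 * q x) (x : H) : q (-x) = q x := by
  simpa using hs (-1) x

theorem polarize_comm (hs : ∀ (c : ℂ) x, q (c • x) = ‖c‖ ^ 2 * q x) (x y : H) :
    polarize q x y = polarize q y x := by
  rw [polarize, polarize, add_comm x y, ← neg_sub y x, quadratic_neg hs]

/-- This is the Jordan–von Neumann argument. Subtracting the parallelogram laws for the pairs `x ±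
z`, `y ± z` cancels `q (x - y)` and leaves `key`, where `z` is doubled. Applying `key` once more
with second vector `0` removes the doubling. -/
theorem polarize_add_left (hs : ∀ (c : ℂ) x, q (c • x) = ‖c‖ ^ 2 * q x)
    (hp : ∀ x y, q (x + y) + q (x - y) = 2 * q x + 2 * q y) (x y z : H) :
    polarize q (x + y) z = polarize q x z + polarize q y z := by
  have key : ∀ x y : H, polarize q x z + polarize q y z = polarize q (x + y) ((2 : ℝ) • z) / 2 := by
    intro x y
    have h1 := hp (x + z) (y + z)
    have h2 := hp (x - z) (y - z)
    have e1 : x + z + (y + z) = x + y + (2 : ℝ) • z := by module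
    have e2 : x + z - (y + z) = x - y := by module
    have e3 : x - z + (y - z) = x + y - (2 : ℝ) • z := by module
    have e4 : x - z - (y - z) = x - y := by module
    rw [e1, e2] at h1
    rw [e3, e4] at h2
    simp only [polarize]
    linarith
  have h0 : polarize q 0 z = 0 := by
    simp [polarize, quadratic_neg hs]
  have := key (x + y) 0
  rw [h0, add_zero, add_zero] at this
  rw [this, key]

theorem polarize_add_right (hs : ∀ (c : ℂ) x, q (c • x) = ‖c‖ ^ 2 * q x)
    (hp : ∀ x y, q (x + y) + q (x - y) = 2 * q x + 2 * q y) (x y z : H) :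
    polarize q x (y + z) = polarize q x y + polarize q x z := by
  simp_rw [polarize_comm hs x, polarize_add_left hs hp]

theorem abs_polarize_le_add (h0 : ∀ x, 0 ≤ q x) (h1 : ∀ x, q x ≤ ‖x‖ ^ 2) (x y : H) :
    |polarize q x y| ≤ (‖x‖ ^ 2 + ‖y‖ ^ 2) / 2 := by
  have h := parallelogram_law_with_norm ℂ x y
  have := h0 (x + y)
  have := h0 (x - y)
  have := h1 (x + y)
  have := h1 (x - y)
  rw [polarize, abs_le]
  constructor <;> nlinarith

/-- Additivity alone gives only rational homogeneity. The bounds on `q` make the additive map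
bounded on the unit ball, hence continuous, hence real-linear. -/
theorem polarize_smul_right (hs : ∀ (c : ℂ) x, q (c • x) = ‖c‖ ^ 2 * q x)
    (hp : ∀ x y, q (x + y) + q (x - y) = 2 * q x + 2 * q y)
    (h0 : ∀ x, 0 ≤ q x) (h1 : ∀ x, q x ≤ ‖x‖ ^ 2) (x y : H) (t : ℝ) :
    polarize q x (t • y) = t * polarize q x y := by
  let f : H →+ ℝ := AddMonoidHom.mk' (polarize q x) (polarize_add_right hs hp x)
  have hf : Continuous f := by
    refine f.continuous_of_isBounded_nhds_zero (Metric.ball_mem_nhds 0 one_pos) ?_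
    refine isBounded_iff_forall_norm_le.2 ⟨(‖x‖ ^ 2 + 1) / 2, ?_⟩
    rintro _ ⟨z, hz, rfl⟩
    have hz : ‖z‖ < 1 := by simpa using hz
    have := abs_polarize_le_add h0 h1 x z
    have : ‖z‖ ^ 2 ≤ 1 := pow_le_one₀ (norm_nonneg z) hz.le
    change |polarize q x z| ≤ _
    linarith
  exact map_real_smul f hf t y

theorem polarize_smul_left (hs : ∀ (c : ℂ) x, q (c • x) = ‖c‖ ^ 2 * q x)
    (hp : ∀ x y, q (x + y) + q (x - y) = 2 * q x + 2 * q y)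
    (h0 : ∀ x, 0 ≤ q x) (h1 : ∀ x, q x ≤ ‖x‖ ^ 2) (x y : H) (t : ℝ) :
    polarize q (t • x) y = t * polarize q x y := by
  rw [polarize_comm hs, polarize_smul_right hs hp h0 h1, polarize_comm hs]

/-- By real bilinearity it suffices to treat normalized vectors, where `abs_polarize_le_add` gives
the bound `(1 + 1) / 2`. The convention `0⁻¹ = 0` lets the zero vector pass through the same
computation. -/
theorem abs_polarize_le (hs : ∀ (c : ℂ) x, q (c • x) = ‖c‖ ^ 2 * q x)
    (hp : ∀ x y, q (x + y) + q (x - y) = 2 * q x + 2 * q y)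
    (h0 : ∀ x, 0 ≤ q x) (h1 : ∀ x, q x ≤ ‖x‖ ^ 2) (x y : H) :
    |polarize q x y| ≤ ‖x‖ * ‖y‖ := by
  have hx : x = ‖x‖ • (‖x‖⁻¹ • x) := by
    rcases eq_or_ne x 0 with rfl | h
    · simp
    · rw [smul_inv_smul₀ (norm_ne_zero_iff.2 h)]
  have hy : y = ‖y‖ • (‖y‖⁻¹ • y) := by
    rcases eq_or_ne y 0 with rfl | h
    · simp
    · rw [smul_inv_smul₀ (norm_ne_zero_iff.2 h)]
  have hn : ∀ z : H, ‖‖z‖⁻¹ • z‖ ≤ 1 := fun z => by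
    rw [norm_smul, norm_inv, norm_norm]
    exact inv_mul_le_one
  have hb := abs_polarize_le_add h0 h1 (‖x‖⁻¹ • x) (‖y‖⁻¹ • y)
  have h2 := pow_le_one₀ (n := 2) (norm_nonneg _) (hn x)
  have h3 := pow_le_one₀ (n := 2) (norm_nonneg _) (hn y)
  rw [hx, hy, polarize_smul_left hs hp h0 h1, polarize_smul_right hs hp h0 h1, abs_mul, abs_mul,
    ← hx, ← hy, abs_norm, abs_norm, ← mul_assoc]
  exact mul_le_of_le_one_right (by positivity) (by linarith)

theorem polarize_I_smul (hs : ∀ (c : ℂ) x, q (c • x) = ‖c‖ ^ 2 * q x) (x y : H) :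
    polarize q (Complex.I • x) (Complex.I • y) = polarize q x y := by
  simp [polarize, ← smul_add, ← smul_sub, hs]

theorem polarize_neg_left (hs : ∀ (c : ℂ) x, q (c • x) = ‖c‖ ^ 2 * q x) (x y : H) :
    polarize q (-x) y = -polarize q x y := by
  simp only [polarize, neg_add_eq_sub]
  rw [← quadratic_neg hs (-x - y), neg_sub, sub_neg_eq_add, add_comm y x,
    ← quadratic_neg hs (y - x), neg_sub]
  ring

theorem polarize_neg_right (hs : ∀ (c : ℂ) x, q (c • x) = ‖c‖ ^ 2 * q x) (x y : H) :
    polarize q x (-y) = -polarize q x y := by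
  rw [polarize_comm hs, polarize_neg_left hs, polarize_comm hs]

theorem polarize_I_smul_left (hs : ∀ (c : ℂ) x, q (c • x) = ‖c‖ ^ 2 * q x) (x y : H) :
    polarize q (Complex.I • x) y = -polarize q x (Complex.I • y) := by
  rw [← polarize_I_smul hs, smul_smul, Complex.I_mul_I, neg_one_smul, polarize_neg_left hs]

theorem polarize_self (hs : ∀ (c : ℂ) x, q (c • x) = ‖c‖ ^ 2 * q x) (x : H) :
    polarize q x x = q x := by
  have : x + x = (2 : ℂ) • x := (two_smul ℂ x).symm
  rw [polarize, sub_self, quadratic_zero hs, this, hs]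
  norm_num

theorem polarize_self_I_smul (hs : ∀ (c : ℂ) x, q (c • x) = ‖c‖ ^ 2 * q x) (x : H) :
    polarize q x (Complex.I • x) = 0 := by
  have h := polarize_I_smul_left hs x x
  rw [polarize_comm hs] at h
  linarith

/-- A quadratic form between `0` and the square of the norm is given by an effect. -/
theorem exists_effect_of_quadratic [CompleteSpace H]
    (hs : ∀ (c : ℂ) x, q (c • x) = ‖c‖ ^ 2 * q x)
    (hp : ∀ x y, q (x + y) + q (x - y) = 2 * q x + 2 * q y)
    (h0 : ∀ x, 0 ≤ q x) (h1 : ∀ x, q x ≤ ‖x‖ ^ 2) :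
    ∃ A : Effect H, ∀ x, ⟪x, A.op x⟫_ℂ = q x := by
  -- The sesquilinear form, antilinear in `x`, whose real part is the polarization. Its imaginary
  -- part vanishes on the diagonal by `polarize_self_I_smul`, so `B x x = q x`.
  let B : H → H → ℂ := fun x y => polarize q x y - Complex.I * polarize q x (Complex.I • y)
  have add_left : ∀ x x' y, B (x + x') y = B x y + B x' y := fun x x' y => by
    simp only [B, polarize_add_left hs hp]; push_cast; ring
  have add_right : ∀ x y y', B x (y + y') = B x y + B x y' := fun x y y' => by
    simp only [B, polarize_add_right hs hp, smul_add]; push_cast; ring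
  have real_left : ∀ (t : ℝ) x y, B ((t : ℂ) • x) y = t * B x y := fun t x y => by
    simp only [B, Complex.coe_smul, polarize_smul_left hs hp h0 h1]; push_cast; ring
  have real_right : ∀ (t : ℝ) x y, B x ((t : ℂ) • y) = t * B x y := fun t x y => by
    simp only [B, Complex.coe_smul, smul_comm Complex.I t, polarize_smul_right hs hp h0 h1]
    push_cast; ring
  have I_left : ∀ x y, B (Complex.I • x) y = -Complex.I * B x y := fun x y => by
    simp only [B, polarize_I_smul_left hs, smul_smul, Complex.I_mul_I, neg_one_smul,
      polarize_neg_right hs]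
    push_cast
    linear_combination -(polarize q x (Complex.I • y) : ℂ) * Complex.I_mul_I
  have I_right : ∀ x y, B x (Complex.I • y) = Complex.I * B x y := fun x y => by
    simp only [B, smul_smul, Complex.I_mul_I, neg_one_smul, polarize_neg_right hs]
    push_cast
    linear_combination (polarize q x (Complex.I • y) : ℂ) * Complex.I_mul_I
  have decomp : ∀ (c : ℂ) (x : H),
      c • x = ((c.re : ℂ) • x) + Complex.I • ((c.im : ℂ) • x) := fun c x => by
    conv_lhs => rw [← Complex.re_add_im c, add_smul, mul_comm, mul_smul]
  have smul_left : ∀ (c : ℂ) x y, B (c • x) y = star c * B x y := fun c x y => by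
    rw [decomp, add_left, I_left, real_left, real_left]
    have : star c = c.re - Complex.I * c.im := by
      apply Complex.ext <;> simp
    rw [this]; ring
  have smul_right : ∀ (c : ℂ) x y, B x (c • y) = c * B x y := fun c x y => by
    rw [decomp, add_right, I_right, real_right, real_right]
    conv_rhs => rw [← Complex.re_add_im c]
    ring
  have bound : ∀ x y, ‖B x y‖ ≤ 2 * (‖x‖ * ‖y‖) := fun x y => by
    have h2 := abs_polarize_le hs hp h0 h1 x y
    have h3 := abs_polarize_le hs hp h0 h1 x (Complex.I • y)
    refine (norm_sub_le _ _).trans ?_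
    rw [norm_mul, Complex.norm_I, one_mul, Complex.norm_real, Complex.norm_real, Real.norm_eq_abs,
      Real.norm_eq_abs]
    rw [norm_smul, Complex.norm_I, one_mul] at h3
    linarith
  -- Estimating real and imaginary parts separately bounds `B` only with constant `2`, while
  -- `exists_op_of_form` asks for constant `1`. So the form is halved here and the operator doubled
  -- afterwards.
  obtain ⟨A, hA⟩ := exists_op_of_form (fun x y => 2⁻¹ * B x y)
    (fun x x' y => by rw [add_left]; ring) (fun c x y => by rw [smul_left]; ring)
    (fun x y y' => by rw [add_right]; ring) (fun c x y => by rw [smul_right]; ring)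
    (fun x y => by
      have := bound x y
      rw [norm_mul, norm_inv, Complex.norm_ofNat]
      linarith)
  have key : ∀ x, ⟪x, ((2 : ℂ) • A) x⟫_ℂ = q x := fun x => by
    rw [_root_.smul_apply, inner_smul_right, hA]
    simp [B, polarize_self hs, polarize_self_I_smul hs]
  refine ⟨⟨(2 : ℂ) • A, op_nonneg_iff.2 fun x => ?_, op_le_iff.2 fun x => ?_⟩, key⟩
  · rw [key]
    exact_mod_cast h0 x
  · rw [key]
    have : ⟪x, (1 : H →L[ℂ] H) x⟫_ℂ = ((‖x‖ ^ 2 : ℝ) : ℂ) := by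
      simp [inner_self_eq_norm_sq_to_K]
    rw [this]
    exact_mod_cast h1 x

end QuadraticForms

/-! Expectation values and rank-one decompositions. -/

section Expectation

variable {H : Type u} [NormedAddCommGroup H] [InnerProductSpace ℂ H]

/-- The expectation value `⟪x, A x⟫`, for positive `A`. -/
noncomputable def expect (A : H →L[ℂ] H) (x : H) : ℝ := (⟪x, A x⟫_ℂ).re

theorem coe_expect {A : H →L[ℂ] H} (hA : 0 ≤ A) (x : H) : (expect A x : ℂ) = ⟪x, A x⟫_ℂ :=
  Complex.ext rfl (Complex.nonneg_iff.1 (op_nonneg_iff.1 hA x)).2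

theorem expect_nonneg {A : H →L[ℂ] H} (hA : 0 ≤ A) (x : H) : 0 ≤ expect A x :=
  (Complex.nonneg_iff.1 (op_nonneg_iff.1 hA x)).1

theorem expect_add (A B : H →L[ℂ] H) (x : H) : expect (A + B) x = expect A x + expect B x := by
  simp [expect]

theorem expect_sub (A B : H →L[ℂ] H) (x : H) : expect (A - B) x = expect A x - expect B x := by
  simp [expect]

theorem expect_smul (r : ℝ) (A : H →L[ℂ] H) (x : H) : expect ((r : ℂ) • A) x = r * expect A x := by
  simp [expect]

theorem expect_one (x : H) : expect (1 : H →L[ℂ] H) x = ‖x‖ ^ 2 := by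
  simp [expect, inner_self_eq_norm_sq_to_K, ← Complex.ofReal_pow]

theorem expect_rankOne (u x : H) : expect (rankOne ℂ u u) x = ‖⟪u, x⟫_ℂ‖ ^ 2 := by
  rw [expect, inner_right_rankOne_apply, ← inner_conj_symm, mul_comm, Complex.mul_conj,
    Complex.ofReal_re, Complex.normSq_eq_norm_sq]

theorem rankOne_self_nonneg (u : H) : 0 ≤ rankOne ℂ u u := op_nonneg_iff.2 fun x => by
  rw [inner_right_rankOne_apply, ← inner_conj_symm, mul_comm, Complex.mul_conj]
  exact_mod_cast Complex.normSq_nonneg _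

theorem op_le_iff_expect {A B : H →L[ℂ] H} (hA : 0 ≤ A) (hB : 0 ≤ B) :
    A ≤ B ↔ ∀ x, expect A x ≤ expect B x := by
  simp_rw [op_le_iff, ← coe_expect hA, ← coe_expect hB, Complex.real_le_real]

theorem op_ext_expect {A B : H →L[ℂ] H} (hA : 0 ≤ A) (hB : 0 ≤ B)
    (h : ∀ x, expect A x = expect B x) : A = B :=
  op_ext fun x => by rw [← coe_expect hA, ← coe_expect hB, h]

theorem op_one_nonneg : (0 : H →L[ℂ] H) ≤ 1 :=
  (ContinuousLinearMap.nonneg_iff_isPositive _).2 ContinuousLinearMap.isPositive_one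

theorem expect_le_norm_sq {A : H →L[ℂ] H} (hA : 0 ≤ A) (h : A ≤ 1) (x : H) :
    expect A x ≤ ‖x‖ ^ 2 := by
  rw [← expect_one]
  exact (op_le_iff_expect hA op_one_nonneg).1 h x

theorem hasSum_norm_sq_inner {ι : Type v} (b : HilbertBasis ι ℂ H) (x : H) :
    HasSum (fun i => ‖⟪b i, x⟫_ℂ‖ ^ 2) (‖x‖ ^ 2) := by
  rw [← Complex.hasSum_ofReal]
  have h := b.hasSum_inner_mul_inner x x
  have h1 : ∀ i, ⟪x, b i⟫_ℂ * ⟪b i, x⟫_ℂ = ((‖⟪b i, x⟫_ℂ‖ ^ 2 : ℝ) : ℂ) := fun i => by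
    rw [← inner_conj_symm x, mul_comm, Complex.mul_conj, Complex.normSq_eq_norm_sq]
  have h2 : ⟪x, x⟫_ℂ = ((‖x‖ ^ 2 : ℝ) : ℂ) := by
    rw [inner_self_eq_norm_sq_to_K]; simp
  simpa only [h1, h2] using h

variable [CompleteSpace H]

/-- The square root of a positive operator. -/
theorem exists_sqrt {A : H →L[ℂ] H} (hA : 0 ≤ A) :
    ∃ R : H →L[ℂ] H, (∀ x y, ⟪R x, y⟫_ℂ = ⟪x, R y⟫_ℂ) ∧ ∀ x, ‖R x‖ ^ 2 = expect A x := by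
  have hR := (ContinuousLinearMap.nonneg_iff_isPositive _).1 (CFC.sqrt_nonneg A)
  have hsymm : ∀ x y, ⟪CFC.sqrt A x, y⟫_ℂ = ⟪x, CFC.sqrt A y⟫_ℂ := hR.1
  refine ⟨CFC.sqrt A, hsymm, fun x => ?_⟩
  have h : A x = CFC.sqrt A (CFC.sqrt A x) := by
    conv_lhs => rw [← CFC.sqrt_mul_sqrt_self A hA]
    rfl
  rw [expect, h, ← hsymm, inner_self_eq_norm_sq_to_K]
  simp [← Complex.ofReal_pow]

/-- A positive operator is a sum of rank-one operators. -/
theorem exists_rankOne_decomposition {A : H →L[ℂ] H} (hA : 0 ≤ A) {ι : Type v}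
    (b : HilbertBasis ι ℂ H) :
    ∃ v : ι → H, (∀ i, ‖v i‖ ^ 2 = expect A (b i)) ∧
      ∀ x, HasSum (fun i => expect (rankOne ℂ (v i) (v i)) x) (expect A x) := by
  -- With `R` the square root of `A`, take `v i = R (b i)`. Since `⟪R (b i), x⟫ = ⟪b i, R x⟫`, the
  -- sum is Parseval's identity for `R x`.
  obtain ⟨R, hR, hRA⟩ := exists_sqrt hA
  refine ⟨fun i => R (b i), fun i => hRA _, fun x => ?_⟩
  simp_rw [expect_rankOne, hR, ← hRA x]
  exact hasSum_norm_sq_inner b (R x)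

end Expectation

/-! Pure states and affine functions of density matrices. -/

section States

variable {H : Type u} [NormedAddCommGroup H] [InnerProductSpace ℂ H]

theorem DensityMatrix.hasSum_expect (ρ : DensityMatrix H) {ι : Type u} (b : HilbertBasis ι ℂ H) :
    HasSum (fun i => expect ρ.op (b i)) 1 := by
  rw [← Complex.hasSum_ofReal]
  simp_rw [coe_expect ρ.nonneg]
  simpa using ρ.trace_eq_one ι b

/-- A positive operator whose diagonal entries sum up to `1` for every orthonormal basis. -/
noncomputable def DensityMatrix.ofExpect (A : H →L[ℂ] H) (hA : 0 ≤ A)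
    (h : ∀ (ι : Type u) (b : HilbertBasis ι ℂ H), HasSum (fun i => expect A (b i)) 1) :
    DensityMatrix H where
  op := A
  nonneg := hA
  trace_eq_one ι b := by
    simp_rw [← coe_expect hA]
    rw [← Complex.ofReal_one]
    exact Complex.hasSum_ofReal.2 (h ι b)

theorem DensityMatrix.ext_expect {ρ σ : DensityMatrix H}
    (h : ∀ x, expect ρ.op x = expect σ.op x) : ρ = σ :=
  DensityMatrix.ext (op_ext_expect ρ.nonneg σ.nonneg h)

theorem Effect.ext_expect {A B : Effect H} (h : ∀ x, expect A.op x = expect B.op x) : A = B :=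
  Effect.ext (op_ext_expect A.nonneg B.nonneg h)

/-- `ρ` is the pure state of the vector `u`: `‖u‖² ρ = |u⟩⟨u|`. -/
def DensityMatrix.IsPure (ρ : DensityMatrix H) (u : H) : Prop :=
  ∀ x, ‖u‖ ^ 2 * expect ρ.op x = ‖⟪u, x⟫_ℂ‖ ^ 2

theorem real_smul_op_nonneg {r : ℝ} (hr : 0 ≤ r) {A : H →L[ℂ] H} (hA : 0 ≤ A) :
    0 ≤ (r : ℂ) • A := op_nonneg_iff.2 fun x => by
  rw [_root_.smul_apply, inner_smul_right]
  exact mul_nonneg (Complex.zero_le_real.2 hr) (op_nonneg_iff.1 hA x)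

theorem DensityMatrix.exists_isPure {u : H} (hu : u ≠ 0) : ∃ ρ : DensityMatrix H, ρ.IsPure u := by
  have hn : (‖u‖ ^ 2) ≠ 0 := pow_ne_zero 2 (norm_ne_zero_iff.2 hu)
  have he : ∀ x, expect ((((‖u‖ ^ 2)⁻¹ : ℝ) : ℂ) • rankOne ℂ u u) x =
      (‖u‖ ^ 2)⁻¹ * ‖⟪u, x⟫_ℂ‖ ^ 2 := fun x => by
    rw [expect_smul, expect_rankOne]
  refine ⟨DensityMatrix.ofExpect _ (real_smul_op_nonneg (r := (‖u‖ ^ 2)⁻¹) (by positivity)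
    (rankOne_self_nonneg u)) ?_, fun x => ?_⟩
  · intro ι b
    simp_rw [he]
    have := (hasSum_norm_sq_inner b u).mul_left (‖u‖ ^ 2)⁻¹
    rw [inv_mul_cancel₀ hn] at this
    simpa only [norm_inner_symm] using this
  · exact (congrArg _ (he x)).trans (mul_inv_cancel_left₀ hn _)

/-- Allows pure states to be chosen for all vectors at once. Every density matrix is a pure state of
`0`, which is harmless because the weight `‖u‖ ^ 2` is then zero. Nonemptiness excludes the trivial
space, which has no density matrix. -/
theorem DensityMatrix.exists_isPure_of_nonempty [Nonempty (DensityMatrix H)] (u : H) :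
    ∃ ρ : DensityMatrix H, ρ.IsPure u := by
  rcases eq_or_ne u 0 with rfl | hu
  · exact ⟨Classical.arbitrary _, fun x => by simp⟩
  · exact DensityMatrix.exists_isPure hu

theorem Effect.ext_of_isPure {A B : Effect H}
    (h : ∀ (u : H) (ρ : DensityMatrix H), ρ.IsPure u → expect A.op u = expect B.op u) : A = B :=
  Effect.ext_expect fun x => by
    rcases eq_or_ne x 0 with rfl | hx
    · simp [expect]
    · obtain ⟨ρ, hρ⟩ := DensityMatrix.exists_isPure hx
      exact h x ρ hρ

theorem DensityMatrix.IsPure.unique {ρ σ : DensityMatrix H} {u : H} (hρ : ρ.IsPure u)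
    (hσ : σ.IsPure u) (hu : u ≠ 0) : ρ = σ :=
  DensityMatrix.ext_expect fun x =>
    mul_left_cancel₀ (pow_ne_zero 2 (norm_ne_zero_iff.2 hu)) ((hρ x).trans (hσ x).symm)

/-- A pure state depends only on the line through its vector; this gives the homogeneity of the
quadratic form in `exists_effect_of_affine`. -/
theorem DensityMatrix.IsPure.smul {ρ : DensityMatrix H} {u : H} (hρ : ρ.IsPure u) (c : ℂ) :
    ρ.IsPure (c • u) := fun x => by
  rw [norm_smul, inner_smul_left, norm_mul, mul_pow, mul_pow, RCLike.norm_conj, ← hρ x, mul_assoc]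

/-- Mixtures of two density matrices. -/
theorem DensityMatrix.exists_mix [CompleteSpace H] (ρ σ : DensityMatrix H) {s t : ℝ}
    (hs : 0 ≤ s) (ht : 0 ≤ t) (h : s + t = 1) :
    ∃ τ : DensityMatrix H, ∀ x, expect τ.op x = s * expect ρ.op x + t * expect σ.op x := by
  have he : ∀ x, expect ((s : ℂ) • ρ.op + (t : ℂ) • σ.op) x =
      s * expect ρ.op x + t * expect σ.op x := fun x => by
    rw [expect_add, expect_smul, expect_smul]
  refine ⟨DensityMatrix.ofExpect ((s : ℂ) • ρ.op + (t : ℂ) • σ.op)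
    (add_nonneg (real_smul_op_nonneg hs ρ.nonneg) (real_smul_op_nonneg ht σ.nonneg)) ?_, he⟩
  intro ι b
  simp_rw [he]
  simpa [h] using ((ρ.hasSum_expect b).mul_left s).add ((σ.hasSum_expect b).mul_left t)

/-- An affine function of density matrices is given by an effect on the pure states. -/
theorem exists_effect_of_affine [CompleteSpace H] (f : DensityMatrix H → ℝ) (h0 : ∀ ρ, 0 ≤ f ρ)
    (h1 : ∀ ρ, f ρ ≤ 1)
    (haff : ∀ (s t : ℝ) (ρ σ τ : DensityMatrix H), 0 ≤ s → 0 ≤ t → s + t = 1 →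
      (∀ x, expect τ.op x = s * expect ρ.op x + t * expect σ.op x) →
      f τ = s * f ρ + t * f σ) :
    ∃ A : Effect H, ∀ (u : H) (ρ : DensityMatrix H), ρ.IsPure u →
      expect A.op u = ‖u‖ ^ 2 * f ρ := by
  rcases isEmpty_or_nonempty (DensityMatrix H) with hE | hE
  · exact ⟨⟨0, le_rfl, op_one_nonneg⟩, fun _ ρ => (hE.false ρ).elim⟩
  choose P hP using DensityMatrix.exists_isPure_of_nonempty (H := H)
  -- The form `‖u‖² f (P u)` does not depend on the choice of `P`: pure states of a nonzero vector
  -- are unique, and at `0` the factor vanishes.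
  have hq : ∀ (u : H) (ρ : DensityMatrix H), ρ.IsPure u → ‖u‖ ^ 2 * f (P u) = ‖u‖ ^ 2 * f ρ := by
    intro u ρ hρ
    rcases eq_or_ne u 0 with rfl | hu
    · simp
    · rw [(hP u).unique hρ hu]
  obtain ⟨A, hA⟩ := exists_effect_of_quadratic (H := H) (q := fun u => ‖u‖ ^ 2 * f (P u))
    (fun c x => by
      rw [hq _ _ ((hP x).smul c), norm_smul]
      ring)
    (fun x y => by
      have hn : ‖x + y‖ ^ 2 + ‖x - y‖ ^ 2 = 2 * (‖x‖ ^ 2 + ‖y‖ ^ 2) := by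
        have := parallelogram_law_with_norm ℂ x y
        linarith

      set s := ‖x‖ ^ 2 + ‖y‖ ^ 2
      -- The mixture weights below divide by `s`, so the case where both vectors vanish is separate.
      rcases (by positivity : 0 ≤ s).eq_or_lt with h | h
      · have hx : ‖x‖ ^ 2 = 0 := le_antisymm (by linarith [sq_nonneg ‖y‖]) (sq_nonneg _)
        have hy : ‖y‖ ^ 2 = 0 := le_antisymm (by linarith [sq_nonneg ‖x‖]) (sq_nonneg _)
        have hxy : ‖x + y‖ ^ 2 = 0 := le_antisymm (by linarith [sq_nonneg ‖x - y‖]) (sq_nonneg _)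
        have hxy' : ‖x - y‖ ^ 2 = 0 := le_antisymm (by linarith [sq_nonneg ‖x + y‖]) (sq_nonneg _)
        simp only [hx, hy, hxy, hxy']
        ring
      · have e1 : ‖x‖ ^ 2 / s + ‖y‖ ^ 2 / s = 1 := by rw [← add_div, div_self h.ne']
        have e2 : ‖x + y‖ ^ 2 / (2 * s) + ‖x - y‖ ^ 2 / (2 * s) = 1 := by
          rw [← add_div, hn, div_self (by positivity)]
        -- The state `τ = (|x⟩⟨x| + |y⟩⟨y|) / s` is also the mixture of the pure states of `x + y`
        -- and `x - y`, by the parallelogram law for the scalars `⟪x, z⟫` and `⟪y, z⟫`. Comparing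
        -- the two values of `f τ` gives the law for the form.
        obtain ⟨τ, hτ⟩ := (P x).exists_mix (P y) (by positivity) (by positivity) e1
        have f1 := haff _ _ _ _ _ (by positivity) (by positivity) e1 hτ
        have f2 := haff _ _ (P (x + y)) (P (x - y)) τ (by positivity) (by positivity) e2
          fun z => by
            have g1 := hP x z
            have g2 := hP y z
            have g3 := hP (x + y) z
            have g4 := hP (x - y) z
            have g5 := parallelogram_law_with_norm ℂ ⟪x, z⟫_ℂ ⟪y, z⟫_ℂ
            rw [← inner_add_left, ← inner_sub_left, ← g1, ← g2, ← g3, ← g4] at g5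
            rw [hτ]
            field_simp
            linarith
        rw [f1] at f2
        field_simp at f2
        linarith)
    (fun x => mul_nonneg (sq_nonneg _) (h0 _))
    (fun x => mul_le_of_le_one_right (sq_nonneg _) (h1 _))
  refine ⟨A, fun u ρ hρ => ?_⟩
  rw [← hq u ρ hρ, expect, hA, Complex.ofReal_re]

end States

/-! Morphisms on effects are countably additive. -/

section SigmaAdditive

variable {H : Type u} [NormedAddCommGroup H] [InnerProductSpace ℂ H]

/-- The rank-one effect `|u⟩⟨u|` for `u` in the unit ball. -/
noncomputable def Effect.ofVec (u : H) (hu : ‖u‖ ≤ 1) : Effect H where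
  op := rankOne ℂ u u
  nonneg := rankOne_self_nonneg u
  le_one := (op_le_iff_expect (rankOne_self_nonneg u) op_one_nonneg).2 fun x => by
    rw [expect_rankOne, expect_one]
    exact pow_le_pow_left₀ (norm_nonneg _)
      ((norm_inner_le_norm u x).trans (mul_le_of_le_one_left (norm_nonneg x) hu)) 2

/-- The identity operator. -/
noncomputable def Effect.one : Effect H := ⟨1, op_one_nonneg, le_rfl⟩

variable [CompleteSpace H]

/-- A density matrix as an effect. -/
noncomputable def DensityMatrix.toEffect (ρ : DensityMatrix H) : Effect H :=
  ⟨ρ.op, ρ.nonneg, ρ.le_one⟩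

variable (ω : SigmaHom (Effect H) unitInterval)

/-- The sum is automatically defined, because `A + B` equals the effect `C` and so lies below `1`.
-/
theorem SigmaHom.map_add {A B C : Effect H}
    (h : ∀ x, expect C.op x = expect A.op x + expect B.op x) :
    (ω.toFun C : ℝ) = ω.toFun A + ω.toFun B := by
  have h : A.op + B.op = C.op :=
    op_ext_expect (add_nonneg A.nonneg B.nonneg) C.nonneg fun x => by rw [expect_add, h]
  exact (mem_oplus_unitInterval.1 (ω.map_oplus ⟨h.trans_le C.le_one, Effect.ext h⟩)).symm

theorem SigmaHom.map_real_smul {A B : Effect H} {t : ℝ} (h0 : 0 ≤ t) (h1 : t ≤ 1)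
    (h : ∀ x, expect B.op x = t * expect A.op x) : (ω.toFun B : ℝ) = t * ω.toFun A := by
  have h : B = EffectModule.smul ⟨t, h0, h1⟩ A := Effect.ext_expect fun x => by
    rw [h]
    exact (expect_smul t A.op x).symm
  rw [h, ω.map_smul]
  rfl

theorem SigmaHom.map_zero_of_op {A : Effect H} (h : ∀ x, expect A.op x = 0) :
    (ω.toFun A : ℝ) = 0 := by
  have := ω.map_real_smul (A := A) (B := A) le_rfl zero_le_one fun x => by rw [h, zero_mul]
  simpa using this

theorem SigmaHom.map_one : (ω.toFun Effect.one : ℝ) = 1 := by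
  have h : (Effect.one : Effect H) = EffectAlgebra.compl zero := Effect.ext (sub_zero _).symm
  rw [h, ω.map_compl, ω.map_zero]
  exact sub_zero _

/-- The partial sums form a countable chain whose join is `A`: an upper bound dominates every
partial sum in expectation, hence also the limit. Preservation of this join and finite additivity
give the series of values. -/
theorem SigmaHom.hasSum_nat {A : Effect H} {E : ℕ → Effect H}
    (h : ∀ x, HasSum (fun i => expect (E i).op x) (expect A.op x)) :
    HasSum (fun i => (ω.toFun (E i) : ℝ)) (ω.toFun A) := by
  have hsum : ∀ n x, expect (∑ k ∈ Finset.range n, (E k).op) x =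
      ∑ k ∈ Finset.range n, expect (E k).op x := fun n x => by
    simp [expect]
  have hnn : ∀ n, 0 ≤ ∑ k ∈ Finset.range n, (E k).op := fun n =>
    Finset.sum_nonneg fun k _ => (E k).nonneg
  have hle : ∀ n, ∑ k ∈ Finset.range n, (E k).op ≤ A.op := fun n =>
    (op_le_iff_expect (hnn n) A.nonneg).2 fun x => by
      rw [hsum]
      exact sum_le_hasSum _ (fun k _ => expect_nonneg (E k).nonneg x) (h x)
  let P : ℕ → Effect H := fun n => ⟨∑ k ∈ Finset.range n, (E k).op, hnn n, (hle n).trans A.le_one⟩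
  have hmono : ∀ m n, m ≤ n → Le (P m) (P n) := fun m n hmn => effect_le_iff.2 <|
    Finset.sum_le_sum_of_subset_of_nonneg (Finset.range_mono hmn) fun k _ _ => (E k).nonneg
  have hω : ∀ n, (ω.toFun (P n) : ℝ) = ∑ k ∈ Finset.range n, (ω.toFun (E k) : ℝ) := by
    intro n
    induction n with
    | zero => exact ω.map_zero_of_op fun x => by rw [hsum, Finset.sum_range_zero]
    | succ n ih =>
      rw [Finset.sum_range_succ, ← ih]
      exact ω.map_add fun x => by rw [hsum, hsum, Finset.sum_range_succ]
  have hjoin : IsJoin (Set.range P) A := by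
    constructor
    · rintro _ ⟨n, rfl⟩
      exact effect_le_iff.2 (hle n)
    · intro T hT
      refine effect_le_iff.2 ((op_le_iff_expect A.nonneg T.nonneg).2 fun x => ?_)
      refine le_of_tendsto' (h x).tendsto_sum_nat fun n => ?_
      rw [← hsum]
      exact (op_le_iff_expect (hnn n) T.nonneg).1 (effect_le_iff.1 (hT (P n) ⟨n, rfl⟩)) x
  have hchain : IsCountableChain (Set.range P) := by
    refine ⟨Set.countable_range P, ?_⟩
    rintro _ ⟨m, rfl⟩ _ ⟨n, rfl⟩ _
    exact (le_total m n).imp (hmono m n) (hmono n m)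
  have hlub := unitInterval_isJoin_iff.1 (ω.map_join _ _ hchain hjoin)
  rw [← Set.range_comp] at hlub
  have hlim := tendsto_atTop_isLUB (fun m n hmn => ω.mono (hmono m n hmn)) hlub
  rw [hasSum_iff_tendsto_nat_of_nonneg fun i => (ω.toFun (E i)).2.1]
  simp_rw [← hω]
  exact (continuous_subtype_val.tendsto _).comp hlim

/-- Reduces to `ℕ` by embedding the index set and filling the gaps with the zero effect, which
covers finite index sets too. -/
theorem SigmaHom.hasSum {ι : Type v} [Countable ι] {A : Effect H} {E : ι → Effect H}
    (h : ∀ x, HasSum (fun i => expect (E i).op x) (expect A.op x)) :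
    HasSum (fun i => (ω.toFun (E i) : ℝ)) (ω.toFun A) := by
  obtain ⟨e, he⟩ := Countable.exists_injective_nat ι
  let Z : Effect H := ⟨0, le_rfl, op_one_nonneg⟩
  have hZ : ∀ x, expect Z.op x = 0 := fun x => by simp [expect, Z]
  have key : ∀ (F : Effect H → ℝ), F Z = 0 → (fun n => F (Function.extend e E (fun _ => Z) n)) =
      Function.extend e (fun i => F (E i)) 0 := fun F hF => funext fun n => by
    rw [Function.apply_extend F]
    congr 1
    exact funext fun _ => hF
  have := ω.hasSum_nat (A := A) (E := Function.extend e E fun _ => Z) fun x => by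
    rw [key (fun B => expect B.op x) (hZ x), hasSum_extend_zero he]
    exact h x
  rwa [key (fun B => (ω.toFun B : ℝ)) (ω.map_zero_of_op hZ), hasSum_extend_zero he] at this

/-- The values of a morphism on rank-one effects are given by a density matrix. -/
theorem SigmaHom.exists_densityMatrix [TopologicalSpace.SeparableSpace H] :
    ∃ ρ : DensityMatrix H, ∀ (u : H) (hu : ‖u‖ ≤ 1),
      expect ρ.op u = ω.toFun (Effect.ofVec u hu) := by
  -- Density matrices are themselves effects, and `ω` restricted to them is affine.
  obtain ⟨A, hA⟩ := exists_effect_of_affine (fun ρ : DensityMatrix H => (ω.toFun ρ.toEffect : ℝ))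
    (fun ρ => (ω.toFun _).2.1) (fun ρ => (ω.toFun _).2.2)
    (fun s t ρ σ τ hs ht hst h => by
      let S : unitInterval := ⟨s, hs, by linarith⟩
      let T : unitInterval := ⟨t, ht, by linarith⟩
      have h1 := ω.map_real_smul (A := ρ.toEffect) (B := EffectModule.smul S ρ.toEffect) hs
        (by linarith) (expect_smul s _)
      have h2 := ω.map_real_smul (A := σ.toEffect) (B := EffectModule.smul T σ.toEffect) ht
        (by linarith) (expect_smul t _)
      rw [← h1, ← h2]
      refine ω.map_add fun x => (h x).trans ?_
      rw [← expect_smul, ← expect_smul]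
      rfl)
  have key : ∀ (u : H) (hu : ‖u‖ ≤ 1), expect A.op u = ω.toFun (Effect.ofVec u hu) := by
    intro u hu
    rcases eq_or_ne u 0 with rfl | h
    · rw [ω.map_zero_of_op fun x => by simp [Effect.ofVec, expect]]
      simp [expect]
    -- The rank-one effect of `u` is the scalar multiple `‖u‖² ρ` of its pure state, and `ω`
    -- respects this scalar.
    · obtain ⟨ρ, hρ⟩ := DensityMatrix.exists_isPure h
      rw [hA u ρ hρ]
      exact (ω.map_real_smul (sq_nonneg _) (pow_le_one₀ (norm_nonneg u) hu) fun x =>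
        (expect_rankOne u x).trans (hρ x).symm).symm
  refine ⟨DensityMatrix.ofExpect A.op A.nonneg fun ι b => ?_, key⟩
  have := countable_of_hilbertBasis b
  have hb : ∀ i, ‖b i‖ ≤ 1 := fun i => (b.orthonormal.1 i).le
  simp_rw [fun i => key (b i) (hb i)]
  -- The trace is `1` because the projections onto the basis vectors sum to the identity and `ω` is
  -- countably additive.
  rw [← ω.map_one]
  refine ω.hasSum fun x => ?_
  simp_rw [Effect.ofVec, expect_rankOne, Effect.one, expect_one]
  exact hasSum_norm_sq_inner b x

end SigmaAdditive

/-! Inverses of morphisms. -/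

theorem giryMap_giryMap {X : Type u} {Y : Type v} {Z : Type w} [MeasurableSpace X]
    [MeasurableSpace Y] [MeasurableSpace Z] {f : X → Y} {g : Y → Z} (hf : Measurable f)
    (hg : Measurable g) (μ : ProbabilityMeasure X) :
    giryMap g hg (giryMap f hf μ) = giryMap (g ∘ f) (hg.comp hf) μ :=
  Subtype.ext (Measure.map_map hg hf)

theorem giryMap_eq_self {X : Type u} [MeasurableSpace X] {f : X → X} (hf : Measurable f)
    (h : ∀ x, f x = x) (μ : ProbabilityMeasure X) : giryMap f hf μ = μ := by
  obtain rfl : f = id := funext h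
  exact Subtype.ext Measure.map_id

/-- A measurable inverse of a morphism of algebras of the Giry monad is a morphism. -/
theorem GiryHom.isomorphic_of_inverse {X : Type u} {Y : Type v} [MeasurableSpace X]
    [MeasurableSpace Y] [GiryAlgebra X] [GiryAlgebra Y] (f : GiryHom X Y) {g : Y → X}
    (hg : Measurable g) (hgf : ∀ x, g (f.toFun x) = x) (hfg : ∀ y, f.toFun (g y) = y) :
    GiryAlgebra.Isomorphic X Y := by
  refine ⟨f, ⟨g, hg, fun μ => ?_⟩, hgf, hfg⟩
  -- Writing the right-hand barycentre as `g (f _)` lets `f` move inside, where `f ∘ g` pushes `μ`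
  -- forward to itself.
  rw [← hgf (GiryAlgebra.act (giryMap g hg μ)), f.map_act, giryMap_giryMap hg f.measurable,
    giryMap_eq_self (f := f.toFun ∘ g) _ hfg]

/-! The probability of an effect in a state. -/

section Probability

variable (H : Type u) [NormedAddCommGroup H] [InnerProductSpace ℂ H] [CompleteSpace H]

/-- The index set of a fixed orthonormal basis. -/
def BasisIndex : Type u := (exists_hilbertBasis ℂ H).choose

/-- A fixed orthonormal basis. -/
noncomputable def stdBasis : HilbertBasis (BasisIndex H) ℂ H :=
  (exists_hilbertBasis ℂ H).choose_spec.choose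

instance instCountableBasisIndex [TopologicalSpace.SeparableSpace H] : Countable (BasisIndex H) :=
  countable_of_hilbertBasis (stdBasis H)

variable {H}

/-- With `ρ = ∑ |v i⟩⟨v i|`, the trace `tr (ρ A)` becomes the series of nonnegative terms `⟪v i, A
(v i)⟫`, so its algebraic properties in `A` hold term by term. -/
theorem DensityMatrix.exists_vec (ρ : DensityMatrix H) : ∃ v : BasisIndex H → H,
    HasSum (fun i => ‖v i‖ ^ 2) 1 ∧ ∀ x, HasSum (fun i => ‖⟪v i, x⟫_ℂ‖ ^ 2) (expect ρ.op x) := by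
  obtain ⟨v, hv, h⟩ := exists_rankOne_decomposition ρ.nonneg (stdBasis H)
  refine ⟨v, ?_, fun x => ?_⟩
  · simp_rw [hv]
    exact ρ.hasSum_expect _
  · simpa only [expect_rankOne] using h x

/-- Vectors with `ρ = ∑ |v i⟩⟨v i|`. -/
noncomputable def DensityMatrix.vec (ρ : DensityMatrix H) : BasisIndex H → H :=
  ρ.exists_vec.choose

theorem DensityMatrix.hasSum_norm_sq_vec (ρ : DensityMatrix H) :
    HasSum (fun i => ‖ρ.vec i‖ ^ 2) 1 := ρ.exists_vec.choose_spec.1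

theorem DensityMatrix.hasSum_inner_vec (ρ : DensityMatrix H) (x : H) :
    HasSum (fun i => ‖⟪ρ.vec i, x⟫_ℂ‖ ^ 2) (expect ρ.op x) := ρ.exists_vec.choose_spec.2 x

theorem DensityMatrix.summable_expect_vec (ρ : DensityMatrix H) (A : Effect H) :
    Summable fun i => expect A.op (ρ.vec i) :=
  Summable.of_nonneg_of_le (fun _ => expect_nonneg A.nonneg _)
    (fun _ => expect_le_norm_sq A.nonneg A.le_one _) ρ.hasSum_norm_sq_vec.summable

/-- The probability `tr (ρ A)` of the effect `A` in the state `ρ`. -/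
noncomputable def DensityMatrix.probFun (ρ : DensityMatrix H) (A : Effect H) : unitInterval :=
  ⟨∑' i, expect A.op (ρ.vec i), tsum_nonneg fun i => expect_nonneg A.nonneg _, by
    rw [← ρ.hasSum_norm_sq_vec.tsum_eq]
    exact (ρ.summable_expect_vec A).tsum_le_tsum
      (fun i => expect_le_norm_sq A.nonneg A.le_one _) ρ.hasSum_norm_sq_vec.summable⟩

theorem DensityMatrix.hasSum_probFun (ρ : DensityMatrix H) (A : Effect H) :
    HasSum (fun i => expect A.op (ρ.vec i)) (ρ.probFun A : ℝ) :=
  (ρ.summable_expect_vec A).hasSum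

theorem DensityMatrix.probFun_add (ρ : DensityMatrix H) {A B C : Effect H}
    (h : ∀ x, expect C.op x = expect A.op x + expect B.op x) :
    (ρ.probFun A : ℝ) + ρ.probFun B = ρ.probFun C := by
  have hC := ρ.hasSum_probFun C
  simp_rw [h] at hC
  exact ((ρ.hasSum_probFun A).add (ρ.hasSum_probFun B)).unique hC

theorem DensityMatrix.probFun_sub (ρ : DensityMatrix H) {A B : Effect H}
    (h : ∀ x, expect B.op x = ‖x‖ ^ 2 - expect A.op x) :
    (ρ.probFun B : ℝ) = 1 - ρ.probFun A := by
  have hB := ρ.hasSum_probFun B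
  simp_rw [h] at hB
  exact hB.unique (ρ.hasSum_norm_sq_vec.sub (ρ.hasSum_probFun A))

theorem DensityMatrix.probFun_smul (ρ : DensityMatrix H) {A B : Effect H} {r : ℝ}
    (h : ∀ x, expect B.op x = r * expect A.op x) :
    (ρ.probFun B : ℝ) = r * ρ.probFun A := by
  have hB := ρ.hasSum_probFun B
  simp_rw [h] at hB
  exact hB.unique ((ρ.hasSum_probFun A).mul_left r)

theorem DensityMatrix.probFun_eq_zero (ρ : DensityMatrix H) {A : Effect H}
    (h : ∀ x, expect A.op x = 0) : (ρ.probFun A : ℝ) = 0 := by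
  have hA := ρ.hasSum_probFun A
  simp_rw [h] at hA
  exact hA.unique hasSum_zero

/-- The join of a nonempty chain of effects is a pointwise limit of expectation values. -/
theorem exists_tendsto_of_isJoin {S : Set (Effect H)} {Z : Effect H} (hS : IsCountableChain S)
    (hZ : IsJoin S Z) (hne : S.Nonempty) : ∃ F : Filter S, F.NeBot ∧
      ∀ x, Filter.Tendsto (fun A : S => expect A.1.op x) F (nhds (expect Z.op x)) := by
  have : Nonempty S := hne.to_subtype
  let _ : Preorder S := Preorder.lift fun A : S => A.1.op
  have hdir : IsDirectedOrder S := ⟨fun A B => by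
    by_cases hAB : A.1 = B.1
    · exact ⟨A, le_rfl, (Subtype.ext hAB : A = B) ▸ le_rfl⟩
    · rcases hS.2 A.2 B.2 hAB with h | h
      · exact ⟨B, effect_le_iff.1 h, le_rfl⟩
      · exact ⟨A, le_rfl, effect_le_iff.1 h⟩⟩
  -- Along an ultrafilter finer than the order filter of the chain, the matrix entries converge by
  -- compactness. The weak limit `T` is a least upper bound, hence equals the given join.
  let U : Ultrafilter S := Ultrafilter.of Filter.atTop
  have hU : (U : Filter S) ≤ Filter.atTop := Ultrafilter.of_le _
  obtain ⟨T, hT⟩ := exists_limit_op U (fun A : S => A.1.op)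
    fun A => norm_op_le_one A.1.nonneg A.1.le_one
  have hub : ∀ A ∈ S, A.op ≤ T := fun A hA => op_le_iff.2 fun x =>
    ge_of_tendsto (hT x x) ((Filter.eventually_ge_atTop (⟨A, hA⟩ : S)).filter_mono hU |>.mono
      fun B hB => op_le_iff.1 hB x)
  have hlub : ∀ B : H →L[ℂ] H, (∀ A ∈ S, A.op ≤ B) → T ≤ B := fun B hB => op_le_iff.2 fun x =>
    le_of_tendsto (hT x x) (Filter.Eventually.of_forall fun A => op_le_iff.1 (hB A.1 A.2) x)
  obtain ⟨A, hA⟩ := hne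
  let T' : Effect H := ⟨T, A.nonneg.trans (hub A hA), hlub 1 fun B _ => B.le_one⟩
  have hTZ : Z.op = T := le_antisymm
    (effect_le_iff.1 (hZ.2 T' fun B hB => effect_le_iff.2 (hub B hB)))
    (hlub Z.op fun B hB => effect_le_iff.1 (hZ.1 B hB))
  refine ⟨U, inferInstance, fun x => ?_⟩
  rw [hTZ]
  exact (Complex.continuous_re.tendsto _).comp (hT x x)

/-- The morphism `A ↦ tr (ρ A)` on effects. -/
noncomputable def DensityMatrix.prob (ρ : DensityMatrix H) :
    SigmaHom (Effect H) unitInterval where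
  toFun := ρ.probFun
  map_oplus := by
    rintro A B _ ⟨h, rfl⟩
    exact mem_oplus_unitInterval.2 (ρ.probFun_add fun x => expect_add A.op B.op x)
  map_compl A := Subtype.ext (ρ.probFun_sub fun x => by
    rw [← expect_one, ← expect_sub]
    rfl)
  map_zero := Subtype.ext (ρ.probFun_eq_zero fun x => by
    change expect (0 : H →L[ℂ] H) x = 0
    simp [expect])
  map_smul r A := Subtype.ext (ρ.probFun_smul fun x => expect_smul (r : ℝ) A.op x)
  map_join S Z hS hZ := by
    have hmono : ∀ A B : Effect H, Le A B → ρ.probFun A ≤ ρ.probFun B := fun A B h =>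
      Subtype.coe_le_coe.1 (hasSum_le
        (fun i => (op_le_iff_expect A.nonneg B.nonneg).1 (effect_le_iff.1 h) _)
        (ρ.hasSum_probFun A) (ρ.hasSum_probFun B))
    rw [unitInterval_isJoin_iff]
    refine ⟨?_, fun c hc => ?_⟩
    · rintro _ ⟨A, hA, rfl⟩
      exact hmono A Z (hZ.1 A hA)
    -- The empty set is a chain as well; its join is the zero effect.
    rcases S.eq_empty_or_nonempty with rfl | hne
    · have hZ0 : Z.op ≤ 0 := effect_le_iff.1 (hZ.2 zero (by simp))
      have hz : ∀ x, expect Z.op x = 0 := fun x => by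
        simp [le_antisymm hZ0 Z.nonneg, expect]
      exact Subtype.coe_le_coe.1 ((ρ.probFun_eq_zero hz).le.trans c.2.1)
    · obtain ⟨F, hF, hlim⟩ := exists_tendsto_of_isJoin hS hZ hne
      -- It suffices to bound finite partial sums for `Z`. Each is a limit of the corresponding sums
      -- for members of the chain, which positivity of the terms bounds by `c`.
      refine Subtype.coe_le_coe.1 (le_of_tendsto' (ρ.hasSum_probFun Z) fun s => ?_)
      refine le_of_tendsto' (tendsto_finsetSum s fun i _ => hlim (ρ.vec i)) fun A => ?_
      exact (sum_le_hasSum s (fun i _ => expect_nonneg A.1.nonneg _) (ρ.hasSum_probFun A.1)).trans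
        (hc ⟨A.1, A.2, rfl⟩)

theorem DensityMatrix.hasSum_prob (ρ : DensityMatrix H) (A : Effect H) :
    HasSum (fun i => expect A.op (ρ.vec i)) (ρ.prob.toFun A : ℝ) := ρ.hasSum_probFun A

theorem DensityMatrix.prob_ofVec (ρ : DensityMatrix H) (u : H) (hu : ‖u‖ ≤ 1) :
    (ρ.prob.toFun (Effect.ofVec u hu) : ℝ) = expect ρ.op u := by
  refine (ρ.hasSum_prob _).unique ?_
  simp_rw [Effect.ofVec, expect_rankOne, norm_inner_symm u]
  exact ρ.hasSum_inner_vec u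

theorem measurable_expect (x : H) : Measurable fun ρ : DensityMatrix H => expect ρ.op x :=
  Complex.measurable_re.comp (DensityMatrix.measurable_inner x x)

variable [TopologicalSpace.SeparableSpace H]

/-- Decomposes the effect rather than the state, so that one family of vectors `v i = √A (b i)`
serves all `ω` and `ρ`. It gives uniqueness of `ω`, measurability in `ρ` and the values on pure
states. -/
theorem Effect.exists_vec (A : Effect H) : ∃ v : BasisIndex H → H, (∀ i, ‖v i‖ ≤ 1) ∧
    (∀ x, HasSum (fun i => ‖⟪v i, x⟫_ℂ‖ ^ 2) (expect A.op x)) ∧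
    ∀ (ω : SigmaHom (Effect H) unitInterval) (ρ : DensityMatrix H),
      (∀ (u : H) (hu : ‖u‖ ≤ 1), expect ρ.op u = ω.toFun (Effect.ofVec u hu)) →
      HasSum (fun i => expect ρ.op (v i)) (ω.toFun A) := by
  obtain ⟨v, hv, h⟩ := exists_rankOne_decomposition A.nonneg (stdBasis H)
  have hv1 : ∀ i, ‖v i‖ ≤ 1 := fun i => by
    have h1 := expect_le_norm_sq A.nonneg A.le_one (stdBasis H i)
    rw [(stdBasis H).orthonormal.1 i, ← hv, one_pow] at h1
    exact (sq_le_one_iff₀ (norm_nonneg _)).1 h1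
  refine ⟨v, hv1, fun x => by simpa only [expect_rankOne] using h x, fun ω ρ hρ => ?_⟩
  simp_rw [fun i => hρ (v i) (hv1 i)]
  exact ω.hasSum h

/-- A morphism on effects is determined by its values on rank-one effects. -/
theorem SigmaHom.ext_ofVec {ω ω' : SigmaHom (Effect H) unitInterval}
    (h : ∀ (u : H) (hu : ‖u‖ ≤ 1), ω.toFun (Effect.ofVec u hu) = ω'.toFun (Effect.ofVec u hu)) :
    ω = ω' := SigmaHom.ext fun A => by
  obtain ⟨ρ, hρ⟩ := ω.exists_densityMatrix
  obtain ⟨v, -, -, hv⟩ := A.exists_vec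
  exact Subtype.ext ((hv ω ρ hρ).unique (hv ω' ρ fun u hu => by rw [hρ, h]))

/-- The density matrix of a morphism on effects. -/
noncomputable def SigmaHom.toDensityMatrix (ω : SigmaHom (Effect H) unitInterval) :
    DensityMatrix H := ω.exists_densityMatrix.choose

theorem SigmaHom.expect_toDensityMatrix (ω : SigmaHom (Effect H) unitInterval) (u : H)
    (hu : ‖u‖ ≤ 1) : expect ω.toDensityMatrix.op u = ω.toFun (Effect.ofVec u hu) :=
  ω.exists_densityMatrix.choose_spec u hu

theorem DensityMatrix.form_toDensityMatrix (ω : SigmaHom (Effect H) unitInterval) (u : H)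
    (hu : ‖u‖ ≤ 1) :
    DensityMatrix.form u hu ω.toDensityMatrix = ω.toFun (Effect.ofVec u hu) :=
  Subtype.ext (ω.expect_toDensityMatrix u hu)

theorem SigmaHom.prob_toDensityMatrix (ω : SigmaHom (Effect H) unitInterval) :
    ω.toDensityMatrix.prob = ω :=
  SigmaHom.ext_ofVec fun u hu => Subtype.ext (by
    rw [DensityMatrix.prob_ofVec, ω.expect_toDensityMatrix u hu])

theorem DensityMatrix.toDensityMatrix_prob (ρ : DensityMatrix H) : ρ.prob.toDensityMatrix = ρ :=
  DensityMatrix.ext_form fun u hu => by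
    rw [DensityMatrix.form_toDensityMatrix]
    exact Subtype.ext (ρ.prob_ofVec u hu)

/-- The vectors `ρ.vec` are chosen and need not depend measurably on `ρ`. Decomposing `A` instead
writes the probability as a countable sum of expectation values of `ρ` at fixed vectors. -/
theorem DensityMatrix.measurable_prob : Measurable (DensityMatrix.prob (H := H)) := by
  refine measurable_to_sigmaHom fun A => ?_
  obtain ⟨v, -, -, hv⟩ := A.exists_vec
  refine Measurable.subtype_mk (f := fun ρ : DensityMatrix H => (ρ.prob.toFun A : ℝ)) ?_
  have h : ∀ ρ : DensityMatrix H, (ρ.prob.toFun A : ℝ) = ∑' i, expect ρ.op (v i) := fun ρ =>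
    (hv ρ.prob ρ fun u hu => (ρ.prob_ofVec u hu).symm).tsum_eq.symm
  simp_rw [h]
  exact Measurable.tsum fun i => measurable_expect (v i)

/-- Polarization expresses every matrix entry through diagonal ones, and scaling brings their
vectors into the unit ball. -/
theorem measurable_to_densityMatrix {X : Type v} [MeasurableSpace X] {g : X → DensityMatrix H}
    (h : ∀ x, ‖x‖ ≤ 1 → Measurable fun a => expect (g a).op x) : Measurable g := by
  have h' : ∀ x, Measurable fun a => ⟪(g a).op x, x⟫_ℂ := fun x => by
    -- Dividing by `‖x‖ + 1` instead of `‖x‖` reaches the unit ball without a case for `x = 0`.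
    have hs : ∀ a, ⟪(g a).op x, x⟫_ℂ =
        (((‖x‖ + 1) ^ 2 * expect (g a).op (((‖x‖ + 1)⁻¹ : ℝ) • x) : ℝ) : ℂ) := fun a => by
      have h1 : expect (g a).op (((‖x‖ + 1)⁻¹ : ℝ) • x) =
          ((‖x‖ + 1)⁻¹) ^ 2 * expect (g a).op x := by
        rw [expect, ContinuousLinearMap.map_smul_of_tower, inner_smul_left_eq_smul,
          inner_smul_right_eq_smul, smul_smul, Complex.smul_re, smul_eq_mul, ← sq]
        rfl
      have hpos : ‖x‖ + 1 ≠ 0 := by positivity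
      rw [h1, ← mul_assoc, ← mul_pow, mul_inv_cancel₀ hpos, one_pow, one_mul,
        coe_expect (g a).nonneg, ← inner_conj_symm, ← coe_expect (g a).nonneg, Complex.conj_ofReal]
    simp_rw [hs]
    refine Complex.measurable_ofReal.comp ((h _ ?_).const_mul _)
    rw [norm_smul, norm_inv, Real.norm_of_nonneg (by positivity)]
    exact inv_mul_le_one_of_le₀ (by linarith [norm_nonneg x]) (by positivity)
  refine DensityMatrix.measurable_of_inner fun x y => ?_
  have hsymm : ∀ a, ⟪x, (g a).op y⟫_ℂ = ⟪(g a).op x, y⟫_ℂ := fun a =>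
    (((ContinuousLinearMap.nonneg_iff_isPositive _).1 (g a).nonneg).1 x y).symm
  simp_rw [hsymm]
  have hpol : ∀ a, ⟪(g a).op x, y⟫_ℂ = _ := fun a =>
    inner_map_polarization' ((g a).op : H →ₗ[ℂ] H) x y
  simp_rw [hpol]
  exact ((((h' _).sub (h' _)).sub ((h' _).const_mul _)).add ((h' _).const_mul _)).div_const _

theorem SigmaHom.measurable_toDensityMatrix :
    Measurable (SigmaHom.toDensityMatrix (H := H)) :=
  measurable_to_densityMatrix fun x hx => by
    simp_rw [fun ω : SigmaHom (Effect H) unitInterval => ω.expect_toDensityMatrix x hx]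
    exact measurable_subtype_coe.comp (measurable_eval _)

/-- Tested on a vector of the unit ball, both sides are the average of the values `ω |x⟩⟨x|`. -/
theorem SigmaHom.toDensityMatrix_act (μ : ProbabilityMeasure (SigmaHom (Effect H) unitInterval)) :
    (GiryAlgebra.act μ).toDensityMatrix =
      GiryAlgebra.act (giryMap _ SigmaHom.measurable_toDensityMatrix μ) :=
  DensityMatrix.ext_form fun x hx => by
    refine (DensityMatrix.form_toDensityMatrix _ x hx).trans
      (Eq.trans ?_ (DensityMatrix.form_act x hx _).symm)
    rw [avg_map _ _ (DensityMatrix.measurable_form x hx)]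
    simp_rw [DensityMatrix.form_toDensityMatrix]
    rfl

end Probability

/-! Discrete probability measures. -/

/-- The discrete probability measure with weights `w i` at the points `σ i`. -/
theorem exists_discrete_probabilityMeasure {X : Type u} [MeasurableSpace X] {ι : Type v}
    {w : ι → ℝ} (hw0 : ∀ i, 0 ≤ w i) (hw : HasSum w 1) (σ : ι → X) :
    ∃ μ : ProbabilityMeasure X, ∀ p : X → unitInterval, Measurable p →
      HasSum (fun i => w i * (p (σ i) : ℝ)) (avg μ p) := by
  let m : Measure X := Measure.sum fun i => ENNReal.ofReal (w i) • Measure.dirac (σ i)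
  have hm : IsProbabilityMeasure m := by
    constructor
    rw [Measure.sum_apply _ MeasurableSet.univ]
    simp only [Measure.smul_apply, measure_univ, smul_eq_mul, mul_one]
    rw [← ENNReal.ofReal_tsum_of_nonneg hw0 hw.summable, hw.tsum_eq, ENNReal.ofReal_one]
  refine ⟨⟨m, hm⟩, fun p hp => ?_⟩
  have hn : ∀ i, 0 ≤ w i * (p (σ i) : ℝ) := fun i => mul_nonneg (hw0 i) (p (σ i)).2.1
  have hs : Summable fun i => w i * (p (σ i) : ℝ) :=
    Summable.of_nonneg_of_le hn (fun i => mul_le_of_le_one_right (hw0 i) (p (σ i)).2.2) hw.summable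
  have h := ofReal_avg ⟨m, hm⟩ hp
  have hpm : Measurable fun x => ENNReal.ofReal (p x : ℝ) :=
    ENNReal.measurable_ofReal.comp (measurable_subtype_coe.comp hp)
  have h2 : ∫⁻ x, ENNReal.ofReal (p x : ℝ) ∂m = ENNReal.ofReal (∑' i, w i * (p (σ i) : ℝ)) := by
    rw [lintegral_sum_measure, ENNReal.ofReal_tsum_of_nonneg hn hs]
    refine tsum_congr fun i => ?_
    rw [lintegral_smul_measure, lintegral_dirac' _ hpm, ENNReal.ofReal_mul (hw0 i), smul_eq_mul]
  have h3 := (ENNReal.ofReal_eq_ofReal_iff (avg ⟨m, hm⟩ p).2.1 (tsum_nonneg hn)).1 (h.trans h2)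
  rw [h3]
  exact hs.hasSum

/-! Isomorphisms of `σ`-effect modules. -/

section Isomorphism

variable {X : Type u} {Y : Type v} [SigmaEffectModule X] [SigmaEffectModule Y]

/-- A surjection that preserves and reflects the order preserves all joins, so continuity of an
isomorphism needs no separate argument. -/
theorem isJoin_image {f : X → Y} {g : Y → X} (hfg : ∀ y, f (g y) = y)
    (h : ∀ {x x'}, Le x x' ↔ Le (f x) (f x')) {S : Set X} {z : X} (hz : IsJoin S z) :
    IsJoin (f '' S) (f z) := by
  refine ⟨?_, fun t ht => ?_⟩
  · rintro _ ⟨x, hx, rfl⟩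
    exact h.1 (hz.1 x hx)
  · rw [← hfg t]
    refine h.1 (hz.2 _ fun x hx => h.2 ?_)
    rw [hfg]
    exact ht _ ⟨x, hx, rfl⟩

/-- A bijection that preserves the operations and reflects sums is an isomorphism. -/
theorem isomorphic_of_bijection (f : X → Y) (g : Y → X) (hgf : ∀ x, g (f x) = x)
    (hfg : ∀ y, f (g y) = y) (hadd : ∀ {x y z : X}, z ∈ oplus x y ↔ f z ∈ oplus (f x) (f y))
    (hcompl : ∀ x, f (EffectAlgebra.compl x) = EffectAlgebra.compl (f x)) (hzero : f zero = zero)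
    (hsmul : ∀ r x, f (EffectModule.smul r x) = EffectModule.smul r (f x)) :
    SigmaEffectModule.Isomorphic Y X := by
  -- The order is defined by sums, so reflecting sums reflects the order.
  have hle : ∀ {x x'}, Le x x' ↔ Le (f x) (f x') := by
    intro x x'
    constructor
    · rintro ⟨z, hz⟩
      exact ⟨f z, hadd.1 hz⟩
    · rintro ⟨z, hz⟩
      exact ⟨g z, hadd.2 (by rwa [hfg])⟩
  refine ⟨⟨g, fun {x y z} h => hadd.2 (by simpa only [hfg] using h), fun y => ?_, ?_,
    fun r y => ?_, fun S z _ hz => isJoin_image hgf (fun {x x'} => ?_) hz⟩,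
    ⟨f, hadd.1, hcompl, hzero, hsmul, fun S z _ hz => isJoin_image hfg hle hz⟩, hfg, hgf⟩
  · rw [← hgf (EffectAlgebra.compl (g y)), hcompl, hfg]
  · rw [← hgf zero, hzero]
  · rw [← hgf (EffectModule.smul r (g y)), hsmul, hfg]
  · rw [hle, hfg, hfg]

end Isomorphism

/-! ### Countable mixtures of states and the two dualities. -/

section Duality

variable {H : Type u} [NormedAddCommGroup H] [InnerProductSpace ℂ H] [CompleteSpace H]
  [TopologicalSpace.SeparableSpace H]

/-- Morphisms on density matrices commute with countable mixtures. -/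
theorem GiryHom.hasSum_of_mixture (φ : GiryHom (DensityMatrix H) unitInterval) {ι : Type v}
    {w : ι → ℝ} (hw0 : ∀ i, 0 ≤ w i) (hw : HasSum w 1) {σ : ι → DensityMatrix H}
    {τ : DensityMatrix H}
    (h : ∀ x, HasSum (fun i => w i * expect (σ i).op x) (expect τ.op x)) :
    HasSum (fun i => w i * (φ.toFun (σ i) : ℝ)) (φ.toFun τ) := by
  obtain ⟨μ, hμ⟩ := exists_discrete_probabilityMeasure hw0 hw σ
  -- The mixture is the barycentre of the discrete measure with weights `w i` at `σ i`.
  have hτ : τ = GiryAlgebra.act μ := DensityMatrix.ext_form fun x hx =>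
    Subtype.ext ((h x).unique (by
      have := hμ _ (DensityMatrix.measurable_form x hx)
      rwa [← DensityMatrix.form_act] at this))
  rw [hτ, φ.apply_act]
  exact hμ _ φ.measurable

/-- A mixture of two states is a mixture indexed by `Bool`, so `φ` is affine and
`exists_effect_of_affine` applies. -/
theorem GiryHom.exists_effect (φ : GiryHom (DensityMatrix H) unitInterval) :
    ∃ A : Effect H, ∀ (u : H) (ρ : DensityMatrix H), ρ.IsPure u →
      expect A.op u = ‖u‖ ^ 2 * φ.toFun ρ := by
  refine exists_effect_of_affine (fun ρ => (φ.toFun ρ : ℝ)) (fun ρ => (φ.toFun ρ).2.1)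
    (fun ρ => (φ.toFun ρ).2.2) fun s t ρ σ τ hs ht hst h => ?_
  have hB : ∀ a b : ℝ, HasSum (fun i : Bool => cond i a b) (a + b) := fun a b => by
    simpa using hasSum_fintype fun i : Bool => cond i a b
  have := φ.hasSum_of_mixture (w := fun i : Bool => cond i s t) (σ := fun i => cond i ρ σ) (τ := τ)
    (by rintro (_ | _) <;> assumption) (hst ▸ hB s t) fun x => by
      rw [h]
      convert hB (s * expect ρ.op x) (t * expect σ.op x) using 2 with i
      cases i <;> rfl
  refine this.unique ?_
  convert hB (s * φ.toFun ρ) (t * φ.toFun σ) using 2 with i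
  cases i <;> rfl

/-- The effect of a morphism on density matrices. -/
noncomputable def GiryHom.toEffect (φ : GiryHom (DensityMatrix H) unitInterval) : Effect H :=
  φ.exists_effect.choose

theorem GiryHom.expect_toEffect (φ : GiryHom (DensityMatrix H) unitInterval) {u : H}
    {ρ : DensityMatrix H} (h : ρ.IsPure u) : expect φ.toEffect.op u = ‖u‖ ^ 2 * φ.toFun ρ :=
  φ.exists_effect.choose_spec u ρ h

/-- The isomorphism of `DM(H)` and `Hom(Ef(H), [0,1])`. -/
noncomputable def densityMatrixHom :
    GiryHom (SigmaHom (Effect H) unitInterval) (DensityMatrix H) :=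
  ⟨SigmaHom.toDensityMatrix, SigmaHom.measurable_toDensityMatrix, SigmaHom.toDensityMatrix_act⟩

theorem isomorphic_sigmaHom_densityMatrix :
    GiryAlgebra.Isomorphic (SigmaHom (Effect H) unitInterval) (DensityMatrix H) :=
  densityMatrixHom.isomorphic_of_inverse DensityMatrix.measurable_prob
    SigmaHom.prob_toDensityMatrix DensityMatrix.toDensityMatrix_prob

/-- Transported along the first isomorphism: `DensityMatrix.prob` inverts a morphism, so it commutes
with barycentres. This avoids exchanging the integral with a series over the chosen vectors `ρ.vec`.
-/
theorem DensityMatrix.prob_act (μ : ProbabilityMeasure (DensityMatrix H)) (A : Effect H) :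
    (DensityMatrix.prob (GiryAlgebra.act μ)).toFun A = avg μ fun ρ => ρ.prob.toFun A := by
  have h : DensityMatrix.prob (GiryAlgebra.act μ) =
      GiryAlgebra.act (giryMap _ DensityMatrix.measurable_prob μ) := by
    rw [← SigmaHom.prob_toDensityMatrix (GiryAlgebra.act (giryMap _ _ μ)),
      SigmaHom.toDensityMatrix_act, giryMap_giryMap,
      giryMap_eq_self (f := SigmaHom.toDensityMatrix ∘ DensityMatrix.prob) _
        DensityMatrix.toDensityMatrix_prob]
  rw [h]
  exact avg_map DensityMatrix.measurable_prob μ (measurable_eval A)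

/-- The morphism `ρ ↦ tr (ρ A)` on density matrices. -/
noncomputable def Effect.toGiryHom (A : Effect H) : GiryHom (DensityMatrix H) unitInterval :=
  GiryHom.ofAvg (fun ρ => ρ.prob.toFun A) ((measurable_eval A).comp DensityMatrix.measurable_prob)
    fun μ => DensityMatrix.prob_act μ A

/-- For `A = ∑ |v i⟩⟨v i|`, both sides are the sum of `‖⟪v i, u⟫‖²`. -/
theorem DensityMatrix.IsPure.prob {ρ : DensityMatrix H} {u : H} (h : ρ.IsPure u) (A : Effect H) :
    ‖u‖ ^ 2 * (ρ.prob.toFun A : ℝ) = expect A.op u := by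
  obtain ⟨v, -, hv, hv'⟩ := A.exists_vec
  have h1 := (hv' ρ.prob ρ fun u hu => (ρ.prob_ofVec u hu).symm).mul_left (‖u‖ ^ 2)
  simp_rw [h _, norm_inner_symm u] at h1
  exact h1.unique (hv u)

/-- Here `ρ` is the mixture of the pure states of the vectors `ρ.vec i` with weights `‖ρ.vec i‖²`.
On pure states `φ` is given by its effect, and countable mixtures extend this to `ρ`. -/
theorem GiryHom.toGiryHom_toEffect (φ : GiryHom (DensityMatrix H) unitInterval) :
    φ.toEffect.toGiryHom = φ := GiryHom.ext_real fun ρ => by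
  have : Nonempty (DensityMatrix H) := ⟨ρ⟩
  choose P hP using DensityMatrix.exists_isPure_of_nonempty (H := H)
  have h := φ.hasSum_of_mixture (w := fun i => ‖ρ.vec i‖ ^ 2) (σ := fun i => P (ρ.vec i)) (τ := ρ)
    (fun i => sq_nonneg _) ρ.hasSum_norm_sq_vec fun x => by
      simp_rw [hP _ x]
      exact ρ.hasSum_inner_vec x
  simp_rw [← φ.expect_toEffect (hP _)] at h
  exact (ρ.hasSum_prob φ.toEffect).unique h

theorem Effect.toEffect_toGiryHom (A : Effect H) : A.toGiryHom.toEffect = A :=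
  Effect.ext_of_isPure fun _ _ hρ => (A.toGiryHom.expect_toEffect hρ).trans (hρ.prob A)

/-- For the converse, evaluation at pure states recovers `A + B = C` as operators; the sum is then
defined because `C ≤ 1`. -/
theorem Effect.mem_oplus_iff {A B C : Effect H} :
    C ∈ oplus A B ↔ C.toGiryHom ∈ oplus A.toGiryHom B.toGiryHom := by
  constructor
  · intro h
    have hs : ∀ ρ : DensityMatrix H, (ρ.prob.toFun A : ℝ) + ρ.prob.toFun B = ρ.prob.toFun C :=
      fun ρ => mem_oplus_unitInterval.1 (ρ.prob.map_oplus h)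
    exact ⟨fun ρ => (hs ρ).trans_le (ρ.prob.toFun C).2.2, GiryHom.ext_real hs⟩
  · rintro ⟨h, h'⟩
    have hs : ∀ ρ : DensityMatrix H, (ρ.prob.toFun A : ℝ) + ρ.prob.toFun B = ρ.prob.toFun C :=
      fun ρ => congrArg (fun k : GiryHom (DensityMatrix H) unitInterval => (k.toFun ρ : ℝ)) h'
    have hop : A.op + B.op = C.op :=
      op_ext_expect (add_nonneg A.nonneg B.nonneg) C.nonneg fun x => by
        rcases eq_or_ne x 0 with rfl | hx
        · simp [expect]
        · obtain ⟨ρ, hρ⟩ := DensityMatrix.exists_isPure hx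
          rw [expect_add, ← hρ.prob, ← hρ.prob, ← hρ.prob, ← mul_add, hs]
    exact ⟨hop.trans_le C.le_one, Effect.ext hop⟩

/-- The operations on Giry morphisms are pointwise, so compatibility with them is the fact that each
`ρ.prob` is a morphism of effect modules. -/
theorem isomorphic_giryHom_effect :
    SigmaEffectModule.Isomorphic (GiryHom (DensityMatrix H) unitInterval) (Effect H) :=
  isomorphic_of_bijection Effect.toGiryHom GiryHom.toEffect Effect.toEffect_toGiryHom
    GiryHom.toGiryHom_toEffect Effect.mem_oplus_iff
    (fun A => GiryHom.ext fun ρ => ρ.prob.map_compl A)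
    (GiryHom.ext fun ρ => ρ.prob.map_zero)
    (fun r A => GiryHom.ext fun ρ => ρ.prob.map_smul r A)

end Duality

end EffectDuality

theorem mainTheorem9 (H : Type u) [NormedAddCommGroup H] [InnerProductSpace ℂ H] [CompleteSpace H]
    [TopologicalSpace.SeparableSpace H] :
    EffectDuality.GiryAlgebra.Isomorphic
        (EffectDuality.SigmaHom (EffectDuality.Effect H) unitInterval)
        (EffectDuality.DensityMatrix H) ∧
      EffectDuality.SigmaEffectModule.Isomorphic
        (EffectDuality.GiryHom (EffectDuality.DensityMatrix H) unitInterval)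
        (EffectDuality.Effect H) :=
  ⟨EffectDuality.isomorphic_sigmaHom_densityMatrix, EffectDuality.isomorphic_giryHom_effect⟩
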